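/- **Setting.** Consider the system $x_{t+1}=f_t(x_t,u_t,w_t)$, $t=0,\dots,H-1$, with $x_t\in\mathbb R^{n_x}$, $u_t\in\mathbb R^{n_u}$, $w_t\in\mathbb R^{n_w}$, and uncertainty $z=(x_0,w)$, $w=(w_0,\dots,w_{H-1})$, with an arbitrary unknown distribution $\mathbb P_z$. A control policy $\pi=(\pi_t)_{t<H}$ gives $u_t=\pi_t(x_0,\dots,x_t)$. A specification is a set of state-input trajectories, and $\varphi(\pi,z)=1$ if the closed-loop trajectory generated by $\pi$ under $z$ belongs to it, $\varphi(\pi,z)=0$ otherwise. The dataset $\boldsymbol D=(\boldsymbol z_1,\dots,\boldsymbol z_N)$ is a list of independent draws from $\mathbb P_z$, and $0\le N_i\le N$, $\delta\in(0,1)$. All maps and sets involved are measurable, in the sense that the events and probabilities below make sense. **P2L.** Let $L$ be a synthesis algorithm, mapping lists of data points to policies. The first $N_i$ data points are used, by any rule, to compute an initial policy $h_0$; let $D'$ be the list of the remaining $N-N_i$ points. Start from $T=\emptyset$ and $h=h_0$. While some $z\in D'\setminus T$ (list difference, repetitions counted) has $\varphi(h,z)=0$, append to $T$ the most unsatisfied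 such $z$ and set $h=L(T)$; here the degree of dissatisfaction is a total order on data points, which may depend on $h$. At termination, return $\pi(D)=h$ and $T$. **Synthesis by IMDP abstraction.** The state space is partitioned into finitely many cells $s$, each with a representative point in it, and there are finitely many abstract actions $a$, each implemented by a control law $x\mapsto\kappa_a(x)$. Given a nonempty list $T$, for cells $s,s'$ and an action $a$ one counts the fraction of the $|T|H$ disturbances $w_t$ in $T$ for which the system moves from the representative point of $s$ into $s'$ under $a$, and builds around this fraction, by any fixed rule that depends on the count and on $|T|H$, an interval contained in $[0,1]$. This gives an interval Markov decision process (IMDP). An abstract policy is computed that attains the maximum in every step of the robust Bellman iteration over the horizon $H$ for the probability of satisfying the specification (an abstract run satisfies it if all trajectories it represents do) against the worst-case transition probabilities in the intervals; $L(T)$ applies in the system the control laws of the actions that this policy selects from the cells visited so far. **The bound.** For $k<n$, $\bar\varepsilon(k,\delta,n)$ is the unique solution in $[k/n,1]$ of $$\frac{\delta}{n}\sum_{m=k}^{n-1}\frac{\binom mk}{\binom nk}(1-\varepsilon)^{-(n-m)}=1,$$ and $\bar\varepsilon(n,\delta,n)=1$. **Corollary.** Let P2L be run with the synthesis algorithm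 by IMDP abstraction, the element to be appended being the largest, in the lexicographic order of the coordinates of $z$, among those that violate $\varphi$. Then the policy $\pi(\boldsymbol D)$ and the list $\boldsymbol T$ returned by P2L satisfy $$\mathbb P\bigl\{R(\boldsymbol D)\le\bar\varepsilon(|\boldsymbol T|,\delta,N-N_i)\bigr\}\ge 1-\delta,\qquad R(D)=\mathbb P_z[z:\varphi(\pi(D),z)=0].$$ The same holds for any other synthesis algorithm $L$ and any other degree of dissatisfaction. -/

import Mathlib

open MeasureTheory ProbabilityTheory

namespace P2L

noncomputable section

/-! ### The risk bound -/

/-- The function `Ψ_{k,δ}` for a sample of size `N`. -/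
def Psi (k : ℕ) (δ : ℝ) (N : ℕ) (ε : ℝ) : ℝ :=
  δ / N * ∑ m ∈ Finset.Ico k N,
    ((m.choose k : ℝ) / (N.choose k : ℝ)) * ((1 - ε) ^ (N - m))⁻¹

theorem choose_ratio_le {k N : ℕ} (hk : k < N) :
    ∀ d m : ℕ, m + d = N → k ≤ m →
      (m.choose k : ℝ) / (N.choose k : ℝ) ≤ (1 - (k : ℝ) / N) ^ d := by
  have hNpos : (0 : ℝ) < N := by exact_mod_cast (Nat.zero_le k).trans_lt hk
  have hCN : (0 : ℝ) < N.choose k := by exact_mod_cast Nat.choose_pos hk.le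
  have hkN : (k : ℝ) / N < 1 := by
    rw [div_lt_one hNpos]; exact_mod_cast hk
  intro d
  induction d with
  | zero =>
    intro m hm _
    have : m = N := by omega
    subst this
    simp [div_self hCN.ne']
  | succ d ih =>
    intro m hm hkm
    have h1 := ih (m + 1) (by omega) (by omega)
    have hid : ((m + 1).choose k : ℝ) * ((m : ℝ) + 1 - k) = m.choose k * ((m : ℝ) + 1) := by
      have := Nat.choose_mul_succ_eq m k
      have h2 : ((m + 1 - k : ℕ) : ℝ) = (m : ℝ) + 1 - k := by
        rw [Nat.cast_sub (by omega)]; push_cast; ring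
      rw [← h2]
      exact_mod_cast this.symm
    have hm1 : (0 : ℝ) < (m : ℝ) + 1 := by positivity
    have hmN : (m : ℝ) + 1 ≤ N := by exact_mod_cast (by omega : m + 1 ≤ N)
    have hfac : ((m : ℝ) + 1 - k) / ((m : ℝ) + 1) ≤ 1 - (k : ℝ) / N := by
      rw [sub_div, div_self hm1.ne']
      have : (k : ℝ) / N ≤ k / ((m : ℝ) + 1) := by gcongr
      linarith
    have hkm' : (k : ℝ) ≤ m := by exact_mod_cast hkm
    have hfac0 : 0 ≤ ((m : ℝ) + 1 - k) / ((m : ℝ) + 1) := by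
      apply div_nonneg <;> linarith
    have heq : (m.choose k : ℝ) / (N.choose k : ℝ)
        = (((m + 1).choose k : ℝ) / (N.choose k : ℝ)) * (((m : ℝ) + 1 - k) / ((m : ℝ) + 1)) := by
      rw [div_mul_div_comm, hid]
      field_simp
    rw [heq, pow_succ]
    apply mul_le_mul h1 hfac hfac0
    apply pow_nonneg; linarith

/-- `Ψ_{k,δ}(ε) = 1` has exactly one solution in `[k/N, 1]`. (At `ε = 1`, where `Ψ` is `+∞`, the
Lean value is `0`, so that `1` is no solution.) -/
theorem existsUnique_Psi {k N : ℕ} {δ : ℝ} (h : k < N ∧ 0 < δ ∧ δ < 1) :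
    ∃! ε : ℝ, ε ∈ Set.Icc ((k : ℝ) / N) 1 ∧ Psi k δ N ε = 1 := by
  obtain ⟨hk, hδ, hδ1⟩ := h
  have hNpos : (0 : ℝ) < N := by exact_mod_cast (Nat.zero_le k).trans_lt hk
  have hCN : (0 : ℝ) < N.choose k := by exact_mod_cast Nat.choose_pos hk.le
  have hkN : (k : ℝ) / N < 1 := by
    rw [div_lt_one hNpos]; exact_mod_cast hk
  have hone : Psi k δ N 1 = 0 := by
    unfold Psi
    rw [Finset.sum_eq_zero, mul_zero]
    intro m hm
    rw [Finset.mem_Ico] at hm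
    rw [sub_self, zero_pow (by omega), inv_zero, mul_zero]
  have hmono : ∀ a b : ℝ, a < b → b < 1 → Psi k δ N a < Psi k δ N b := by
    intro a b hab hb
    unfold Psi
    apply mul_lt_mul_of_pos_left _ (by positivity)
    apply Finset.sum_lt_sum_of_nonempty (Finset.nonempty_Ico.2 hk)
    intro m hm
    rw [Finset.mem_Ico] at hm
    have hCm : (0 : ℝ) < m.choose k := by exact_mod_cast Nat.choose_pos hm.1
    apply mul_lt_mul_of_pos_left _ (by positivity)
    have hb' : 0 < 1 - b := by linarith
    apply inv_strictAnti₀ (by positivity)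
    exact pow_lt_pow_left₀ (by linarith) hb'.le (by omega)
  have hlow : Psi k δ N ((k : ℝ) / N) < 1 := by
    have hq : 0 < 1 - (k : ℝ) / N := by linarith
    have hsum : ∑ m ∈ Finset.Ico k N, ((m.choose k : ℝ) / (N.choose k : ℝ)) *
        ((1 - (k : ℝ) / N) ^ (N - m))⁻¹ ≤ ∑ _m ∈ Finset.Ico k N, (1 : ℝ) := by
      apply Finset.sum_le_sum
      intro m hm
      rw [Finset.mem_Ico] at hm
      rw [← div_eq_mul_inv, div_le_one (by positivity)]
      exact choose_ratio_le hk (N - m) m (by omega) hm.1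
    have hcard : ∑ _m ∈ Finset.Ico k N, (1 : ℝ) ≤ N := by
      simp
    unfold Psi
    calc _ ≤ δ / N * N := by
          apply mul_le_mul_of_nonneg_left (hsum.trans hcard) (by positivity)
      _ = δ := by field_simp
      _ < 1 := hδ1
  -- a point below `1` at which `Ψ` is at least `1`
  let c : ℝ := δ / N * (1 / (N.choose k : ℝ))
  have hc : 0 < c := by positivity
  let r : ℝ := min c (1 - (k : ℝ) / N)
  have hr : 0 < r := lt_min hc (by linarith)
  have hrc : r ≤ c := min_le_left _ _
  have hrk : r ≤ 1 - (k : ℝ) / N := min_le_right _ _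
  have hk0 : 0 ≤ (k : ℝ) / N := by positivity
  have hr1 : r ≤ 1 := by linarith
  have hhigh : 1 ≤ Psi k δ N (1 - r) := by
    have hterm : 1 / (N.choose k : ℝ) * r⁻¹ ≤ ∑ m ∈ Finset.Ico k N,
        ((m.choose k : ℝ) / (N.choose k : ℝ)) * ((1 - (1 - r)) ^ (N - m))⁻¹ := by
      have hmem : k ∈ Finset.Ico k N := by simp [hk]
      refine le_trans ?_ (Finset.single_le_sum
        (f := fun m : ℕ => ((m.choose k : ℝ) / (N.choose k : ℝ)) *
          ((1 - (1 - r)) ^ (N - m))⁻¹) ?_ hmem)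
      · simp only [Nat.choose_self, Nat.cast_one, sub_sub_cancel]
        apply mul_le_mul_of_nonneg_left _ (by positivity)
        apply inv_anti₀ (by positivity)
        exact pow_le_of_le_one hr.le hr1 (by omega)
      · intro m _
        simp only [sub_sub_cancel]
        positivity
    unfold Psi
    calc (1 : ℝ) ≤ c * r⁻¹ := by
          rw [← div_eq_mul_inv, one_le_div hr]; exact hrc
      _ = δ / N * (1 / (N.choose k : ℝ) * r⁻¹) := by simp only [c]; ring
      _ ≤ _ := mul_le_mul_of_nonneg_left hterm (by positivity)
  have hcont : ContinuousOn (Psi k δ N) (Set.Icc ((k : ℝ) / N) (1 - r)) := by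
    unfold Psi
    apply ContinuousOn.mul continuousOn_const
    apply continuousOn_finsetSum
    intro m _
    apply ContinuousOn.mul continuousOn_const
    apply ContinuousOn.inv₀ (by fun_prop)
    intro x hx
    have : 0 < 1 - x := by linarith [hx.2]
    positivity
  obtain ⟨ε, hε, hε1⟩ := intermediate_value_Icc (by linarith) hcont ⟨hlow.le, hhigh⟩
  refine ⟨ε, ⟨⟨hε.1, by linarith [hε.2]⟩, hε1⟩, ?_⟩
  rintro y ⟨hy, hy1⟩
  have hylt : y < 1 := by
    rcases hy.2.lt_or_eq with h | h
    · exact h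
    · rw [h, hone] at hy1; norm_num at hy1
  have hεlt : ε < 1 := by linarith [hε.2]
  rcases lt_trichotomy y ε with h | h | h
  · have := hmono y ε h hεlt; rw [hy1, hε1] at this; exact absurd this (lt_irrefl _)
  · exact h
  · have := hmono ε y h hylt; rw [hy1, hε1] at this; exact absurd this (lt_irrefl _)

open Classical in
/-- The bound `ε̄(k,δ,N)`: for `k < N` the unique solution of `Ψ_{k,δ}(ε) = 1` in `[k/N, 1]`,
and `1` for `k = N`. -/
def epsBar (k : ℕ) (δ : ℝ) (N : ℕ) : ℝ :=
  if h : k < N ∧ 0 < δ ∧ δ < 1 then (existsUnique_Psi h).choose else 1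

/-! ### The meta-algorithm P2L

`Z` is the space of data points and `Dec` the space of decisions. -/

section Meta

variable {Z Dec : Type*}

open Classical in
/-- The elements of `D \ T` that do not satisfy the property with the decision `h`. -/
def unsatisfied (φ : Dec → Z → Prop) (D : List Z) (h : Dec) (T : List Z) : Finset Z :=
  ((D.diff T).filter fun z => ¬ φ h z).toFinset

open Classical in
/-- One pass through the loop: while some element of `D \ T` is unsatisfied, the most unsatisfied
one (the largest in the order `ord h`) is appended to `T` and the decision is synthesized anew. -/
def step (L : List Z → Dec) (φ : Dec → Z → Prop) (ord : Dec → LinearOrder Z) (D : List Z)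
    (c : Dec × List Z) : Dec × List Z :=
  if hne : (unsatisfied φ D c.1 c.2).Nonempty then
    let zbar : Z := @Finset.max' Z (ord c.1) (unsatisfied φ D c.1 c.2) hne
    (L (c.2 ++ [zbar]), c.2 ++ [zbar])
  else c

/-- The output `(h, T)` of P2L on the list `D`, started from the decision `h₀`. Each pass that does
not terminate uses up one element of `D`, so the loop ends after at most `|D|` passes, and further
passes change nothing. -/
def p2l (L : List Z → Dec) (φ : Dec → Z → Prop) (ord : Dec → LinearOrder Z) (h₀ : Dec)
    (D : List Z) : Dec × List Z :=
  (step L φ ord D)^[D.length] (h₀, [])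

/-- P2L when the first `Ni` data points are used for the initial decision only, and the loop runs
on the other ones. -/
def p2lInit (L : List Z → Dec) (φ : Dec → Z → Prop) (ord : Dec → LinearOrder Z)
    (init : List Z → Dec) (Ni : ℕ) (D : List Z) : Dec × List Z :=
  p2l L φ ord (init (D.take Ni)) (D.drop Ni)

/-- Measurability of a synthesis map on lists of length `k`: violation of the property, and the
comparison of two data points by degree of dissatisfaction, are measurable in the data. -/
def MeasurableRule [MeasurableSpace Z] (φ : Dec → Z → Prop) (ord : Dec → LinearOrder Z)
    (L : List Z → Dec) (k : ℕ) : Prop :=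
  MeasurableSet {p : (Fin k → Z) × Z | ¬ φ (L (List.ofFn p.1)) p.2} ∧
  MeasurableSet {p : (Fin k → Z) × Z × Z | (ord (L (List.ofFn p.1))).le p.2.1 p.2.2}

end Meta

/-! ### The control problem -/

/-- The uncertainty `z = (x₀, w)` with `w = (w₀, …, w_{H-1})`. -/
abbrev Uncertainty (nx nw H : ℕ) : Type :=
  (Fin nx → ℝ) × (Fin H → Fin nw → ℝ)

/-- The maps `f_t` in `x_{t+1} = f_t(x_t, u_t, w_t)`. -/
abbrev Dynamics (nx nu nw H : ℕ) : Type :=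
  Fin H → (Fin nx → ℝ) → (Fin nu → ℝ) → (Fin nw → ℝ) → (Fin nx → ℝ)

/-- A state-feedback policy `u_t = π_t(x_0, …, x_t)`. -/
abbrev Policy (nx nu H : ℕ) : Type :=
  (t : Fin H) → (Fin ((t : ℕ) + 1) → Fin nx → ℝ) → (Fin nu → ℝ)

/-- State and input trajectories `(x_0, …, x_H)` and `(u_0, …, u_{H-1})`. -/
abbrev Trajectory (nx nu H : ℕ) : Type :=
  (Fin (H + 1) → Fin nx → ℝ) × (Fin H → Fin nu → ℝ)

section Control

variable {nx nu nw H : ℕ}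

/-- The states `x_0, …, x_t` of the closed loop (used for `t ≤ H`; constant after time `H`). -/
def states (f : Dynamics nx nu nw H) (π : Policy nx nu H) (z : Uncertainty nx nw H) :
    (t : ℕ) → Fin (t + 1) → (Fin nx → ℝ)
  | 0 => fun _ => z.1
  | t + 1 =>
    Fin.snoc (α := fun _ => Fin nx → ℝ) (states f π z t)
      (if h : t < H then
        f ⟨t, h⟩ (states f π z t (Fin.last t)) (π ⟨t, h⟩ (states f π z t)) (z.2 ⟨t, h⟩)
      else states f π z t (Fin.last t))

/-- The closed-loop trajectory generated by `π` under `z`. -/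
def closedLoop (f : Dynamics nx nu nw H) (π : Policy nx nu H) (z : Uncertainty nx nw H) :
    Trajectory nx nu H :=
  (states f π z H, fun t => π t (states f π z t))

/-- The property `φ(π, z) = 1`: the closed-loop trajectory meets the specification, which is given
as the set of the trajectories that meet it. -/
def Satisfies (f : Dynamics nx nu nw H) (Spec : Set (Trajectory nx nu H))
    (π : Policy nx nu H) (z : Uncertainty nx nw H) : Prop :=
  closedLoop f π z ∈ Spec

/-- The coordinates of `z = (x₀, w₀, …, w_{H-1})`, to be compared lexicographically. -/
def lexKey (z : Uncertainty nx nw H) :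
    Lex (Lex (Fin nx → ℝ) × Lex (Fin H → Lex (Fin nw → ℝ))) :=
  toLex (toLex z.1, toLex fun t => toLex (z.2 t))

theorem lexKey_injective :
    Function.Injective (lexKey : Uncertainty nx nw H → _) := by
  intro a b hab
  have h := Prod.ext_iff.1 (toLex.injective hab)
  have h1 : a.1 = b.1 := toLex.injective h.1
  have h2 := toLex.injective h.2
  refine Prod.ext h1 (funext fun t => ?_)
  exact toLex.injective (congrFun h2 t)

/-- The lexicographic order on the data points. -/
@[reducible]
def lexOrder : LinearOrder (Uncertainty nx nw H) :=
  LinearOrder.lift' lexKey lexKey_injective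

end Control

/-! ### Synthesis through an interval Markov decision process -/

/-- An interval Markov decision process with states `S` and actions `A`: bounds on the transition
probability from `s` to `s'` under `a`. -/
structure IMDP (S A : Type) where
  lo : S → A → S → ℝ
  hi : S → A → S → ℝ

/-- The transition distributions from `s` under `a` that the intervals allow. -/
def IMDP.transitions {S A : Type} [Fintype S] (M : IMDP S A) (s : S) (a : A) : Set (S → ℝ) :=
  {p | (∀ s', 0 ≤ p s') ∧ ∑ s', p s' = 1 ∧ ∀ s', M.lo s a s' ≤ p s' ∧ p s' ≤ M.hi s a s'}

/-- A deterministic policy on the abstraction: it picks the action at time `t` from the states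
visited up to `t` and the actions taken before `t`. -/
abbrev AbsPolicy (S A : Type) : Type :=
  (t : ℕ) → (Fin (t + 1) → S) → (Fin t → A) → A

/-- A discretization of the state-control space: a partition of the state space into nonempty cells
indexed by `S`, a point in each cell, and a control law for each abstract action (for a plain
gridding of the input space, a constant one). -/
structure Discretization (nx nu : ℕ) (S A : Type) where
  cell : (Fin nx → ℝ) → S
  rep : S → (Fin nx → ℝ)
  cell_rep : ∀ s, cell (rep s) = s
  ctrl : A → (Fin nx → ℝ) → (Fin nu → ℝ)

/-- A rule that builds a probability interval around the fraction `k / n` of `k` occurrences in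
`n` trials. -/
structure IntervalRule where
  lo : ℕ → ℕ → ℝ
  hi : ℕ → ℕ → ℝ
  lo_nonneg : ∀ k n, 0 ≤ lo k n
  hi_le_one : ∀ k n, hi k n ≤ 1
  lo_le : ∀ k n : ℕ, 0 < n → k ≤ n → lo k n ≤ (k : ℝ) / n
  le_hi : ∀ k n : ℕ, 0 < n → k ≤ n → (k : ℝ) / n ≤ hi k n

section Abstraction

variable {nx nu nw H : ℕ} {S A : Type}

open Classical in
/-- The number of disturbances `w_t` in the data `T` under which the system moves from (the
representative point of) the cell `s` to the cell `s'` when action `a` is applied. -/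
def transitionCount (f : Dynamics nx nu nw H) (G : Discretization nx nu S A)
    (T : List (Uncertainty nx nw H)) (s : S) (a : A) (s' : S) : ℕ :=
  (T.map fun z =>
    (Finset.univ.filter fun t : Fin H =>
      G.cell (f t (G.rep s) (G.ctrl a (G.rep s)) (z.2 t)) = s').card).sum

/-- The IMDP estimated from the `|T| * H` disturbances in the data `T`. -/
def empiricalIMDP (f : Dynamics nx nu nw H) (G : Discretization nx nu S A) (I : IntervalRule)
    (T : List (Uncertainty nx nw H)) : IMDP S A where
  lo s a s' := I.lo (transitionCount f G T s a s') (T.length * H)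
  hi s a s' := I.hi (transitionCount f G T s a s') (T.length * H)

/-- An abstract run satisfies the specification if every trajectory that it stands for does. -/
def AbsSatisfies (G : Discretization nx nu S A) (Spec : Set (Trajectory nx nu H))
    (t : ℕ) (σ : Fin (t + 1) → S) (α : Fin t → A) : Prop :=
  ∀ (x : Fin (H + 1) → Fin nx → ℝ) (u : Fin H → Fin nu → ℝ),
    (∀ (i : Fin (H + 1)) (h : (i : ℕ) < t + 1), G.cell (x i) = σ ⟨i, h⟩) →
    (∀ (i : Fin H) (h : (i : ℕ) < t), u i = G.ctrl (α ⟨i, h⟩) (x i.castSucc)) →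
    (x, u) ∈ Spec

/-- The expectation of `V` after the action `a`, in the worst case over the allowed transition
distributions of the next state, for a function `V` of the run after that transition. -/
def worstCase [Fintype S] (M : IMDP S A) {t : ℕ}
    (V : (Fin (t + 2) → S) → (Fin (t + 1) → A) → ℝ)
    (σ : Fin (t + 1) → S) (α : Fin t → A) (a : A) : ℝ :=
  ⨅ p : M.transitions (σ (Fin.last t)) a, ∑ s', p.1 s' *
    V (Fin.snoc (α := fun _ => S) σ s') (Fin.snoc (α := fun _ => A) α a)

open Classical in
/-- Robust Bellman iteration: with `n` steps to go at time `t`, the largest probability of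
satisfying the specification that can be guaranteed against the worst-case transitions. -/
def robustValue [Fintype S] (M : IMDP S A) (G : Discretization nx nu S A)
    (Spec : Set (Trajectory nx nu H)) :
    (n t : ℕ) → (Fin (t + 1) → S) → (Fin t → A) → ℝ
  | 0, t, σ, α => if AbsSatisfies G Spec t σ α then 1 else 0
  | n + 1, t, σ, α => ⨆ a : A, worstCase M (robustValue M G Spec n (t + 1)) σ α a

/-- A policy on the abstraction that attains the maximum in every robust Bellman step over the
horizon `H`. -/
def IsRobustlyOptimal [Fintype S] (M : IMDP S A) (G : Discretization nx nu S A)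
    (Spec : Set (Trajectory nx nu H)) (ρ : AbsPolicy S A) : Prop :=
  ∀ (t : ℕ), t < H → ∀ (σ : Fin (t + 1) → S) (α : Fin t → A) (a : A),
    worstCase M (robustValue M G Spec (H - (t + 1)) (t + 1)) σ α a ≤
      worstCase M (robustValue M G Spec (H - (t + 1)) (t + 1)) σ α (ρ t σ α)

/-- The actions that `ρ` takes before time `t` along the cells `σ`. -/
def pastActions (ρ : AbsPolicy S A) : (t : ℕ) → (Fin (t + 1) → S) → (Fin t → A)
  | 0, _ => Fin.elim0
  | t + 1, σ =>
    Fin.snoc (α := fun _ => A) (pastActions ρ t (Fin.init σ))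
      (ρ t (Fin.init σ) (pastActions ρ t (Fin.init σ)))

/-- The control policy for the system that carries out `ρ`. -/
def refinePolicy (G : Discretization nx nu S A) (ρ : AbsPolicy S A) : Policy nx nu H :=
  fun t x =>
    G.ctrl (ρ t (fun i => G.cell (x i)) (pastActions ρ t fun i => G.cell (x i)))
      (x (Fin.last t))

/-- The abstraction-based synthesis algorithm: estimate the IMDP, solve it, refine the solution to
a control policy. -/
def imdpSynthesis (f : Dynamics nx nu nw H) (G : Discretization nx nu S A) (I : IntervalRule)
    (solver : IMDP S A → AbsPolicy S A) (T : List (Uncertainty nx nw H)) : Policy nx nu H :=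
  refinePolicy G (solver (empiricalIMDP f G I T))

end Abstraction

end

end P2L

open P2L

/-!
The proof treats P2L as a sample compression scheme and bounds the law of the compressed sample.

For a fixed initial decision let `c(x)` be the list that P2L selects from the sample `x`. It is the
only list whose elements are, one after the other, the most unsatisfied remaining points, and after
which nothing unsatisfied remains (`Selects`, `p2l_snd_eq_iff`). Hence `c` does not depend on the
order of the sample, and it is *preferent*: a selected list stays selected when a point outside of it
is dropped, and that point satisfies the property under the final decision (`p2l_snd_of_append`).

Write `q(τ)` for the probability that a fresh point satisfies the property under the decision made
from `τ`, and let `ρ_m` be the law of the first `k` points of a sample of size `m`, restricted to the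
event that they form `c(x)`. Exchangeability gives, for every set `B` of lists of length `k`,
`P_m(c ∈ B) = m (m - 1) ⋯ (m - k + 1) ρ_m(B)` (`measure_selected_mem`). When data points are
repeated, several placements of `c(x)` in the sample are possible; `ρ_m` then carries the weight
`1 / (number of placements)`. That number can only grow with the sample, so preference still gives
`dρ_n ≤ q ^ (n - m) dρ_m` for `m ≤ n` (`lintegral_selectionMeasure_add_le`).

Let `B` be the set of those `τ` of length `k < n` whose risk `1 - q(τ)` exceeds `ε̄(k, δ, n)`. On `B`
the defining equation of `ε̄` yields
`C(n, k) ≤ (δ / n) ∑_{k ≤ m < n} C(m, k) q ^ (-(n - m))` (`choose_le_of_epsBar_lt`). Integrating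
against `ρ_n` and using the density bound, one obtains
`P_n(c ∈ B) ≤ (δ / n) ∑_{k ≤ m < n} P_m(|c| = k)`. Summed over `k`, the right-hand side is at most
`(δ / n) ∑_{m < n} 1 = δ` (`measure_epsBar_lt_le`).

The data points used for the initial decision are independent of the others, so the bound holds
conditionally on them and, by Fubini, unconditionally (`risk_le_epsBar`). The events are measurable
because selection of given positions is a finite combination of conditions on violation and order.
The synthesis by abstraction is covered because the IMDP depends on the data only through finitely
many counts (`measurableRule_imdpSynthesis`).
-/

namespace P2L

/-! ### The output of the loop -/

section Loop

variable {Z Dec : Type*} {L : List Z → Dec} {φ : Dec → Z → Prop} {ord : Dec → LinearOrder Z}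
  {h₀ : Dec}

/-- The decision that the loop holds when its list is `T`: the initial one `h₀` as long as nothing
has been appended, the synthesized one afterwards. -/
def decision (L : List Z → Dec) (h₀ : Dec) : List Z → Dec
  | [] => h₀
  | z :: T => L (z :: T)

open Classical in
theorem mem_unsatisfied {D T : List Z} {h : Dec} {z : Z} :
    z ∈ unsatisfied φ D h T ↔ T.count z < D.count z ∧ ¬ φ h z := by
  rw [unsatisfied, List.mem_toFinset, List.mem_filter, ← List.count_pos_iff, List.count_diff]
  simp

theorem decision_append_singleton (T : List Z) (z : Z) :
    decision L h₀ (T ++ [z]) = L (T ++ [z]) := by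
  cases T <;> rfl

/-- The loop on `D` can have built the list `T`: each element of `T` is the most unsatisfied one
under the decision held when it was appended. -/
def IsGreedy (L : List Z → Dec) (φ : Dec → Z → Prop) (ord : Dec → LinearOrder Z) (h₀ : Dec)
    (D T : List Z) : Prop :=
  ∀ (i : ℕ) (hi : i < T.length),
    T[i] ∈ unsatisfied φ D (decision L h₀ (T.take i)) (T.take i) ∧
    ∀ z ∈ unsatisfied φ D (decision L h₀ (T.take i)) (T.take i),
      (ord (decision L h₀ (T.take i))).le z T[i]

/-- The loop on `D` can have built the list `T`, and stops there. -/
def Selects (L : List Z → Dec) (φ : Dec → Z → Prop) (ord : Dec → LinearOrder Z) (h₀ : Dec)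
    (D T : List Z) : Prop :=
  IsGreedy L φ ord h₀ D T ∧ unsatisfied φ D (decision L h₀ T) T = ∅

theorem IsGreedy.append_singleton {D T : List Z} {z : Z} (hT : IsGreedy L φ ord h₀ D T)
    (hz : z ∈ unsatisfied φ D (decision L h₀ T) T)
    (hmax : ∀ y ∈ unsatisfied φ D (decision L h₀ T) T, (ord (decision L h₀ T)).le y z) :
    IsGreedy L φ ord h₀ D (T ++ [z]) := by
  intro i hi
  rw [List.length_append, List.length_singleton] at hi
  rcases Nat.lt_succ_iff_lt_or_eq.1 hi with h | rfl
  · rw [List.take_append_of_le_length h.le, List.getElem_append_left h]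
    exact hT i h
  · rw [List.getElem_concat_length rfl, List.take_left]
    exact ⟨hz, hmax⟩

theorem IsGreedy.subperm {D T : List Z} (hT : IsGreedy L φ ord h₀ D T) : T.Subperm D := by
  classical
  have key : ∀ i ≤ T.length, ∀ a, (T.take i).count a ≤ D.count a := by
    intro i
    induction i with
    | zero => simp
    | succ i ih =>
      intro hi a
      have h1 := (mem_unsatisfied.1 (hT i hi).1).1
      have h2 := ih (by omega) a
      rw [← List.take_append_getElem hi, List.count_append, List.count_singleton]
      split_ifs with h
      · rw [beq_iff_eq] at h
        subst h
        omega
      · simpa using h2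
  rw [List.subperm_iff_count]
  simpa using key T.length le_rfl

/-- After `t` passes the loop has either appended `t` elements or come to its end. -/
theorem iterate_step (L : List Z → Dec) (φ : Dec → Z → Prop) (ord : Dec → LinearOrder Z)
    (h₀ : Dec) (D : List Z) (t : ℕ) :
    let c := (step L φ ord D)^[t] (h₀, [])
    c.1 = decision L h₀ c.2 ∧ IsGreedy L φ ord h₀ D c.2 ∧
      (c.2.length = t ∨ unsatisfied φ D c.1 c.2 = ∅) := by
  induction t with
  | zero => exact ⟨rfl, fun i hi => absurd hi (by simp), Or.inl rfl⟩
  | succ t ih =>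
    simp only [Function.iterate_succ_apply'] at ih ⊢
    set c := (step L φ ord D)^[t] (h₀, [])
    obtain ⟨h1, h2, h3⟩ := ih
    by_cases hne : (unsatisfied φ D c.1 c.2).Nonempty
    · have hlen : c.2.length = t := h3.resolve_right hne.ne_empty
      rw [step, dif_pos hne]
      refine ⟨(decision_append_singleton _ _).symm, ?_, Or.inl (by simp [hlen])⟩
      apply h2.append_singleton
      · rw [← h1]
        exact @Finset.max'_mem Z (ord c.1) _ hne
      · rw [← h1]
        exact fun y hy => @Finset.le_max' Z (ord c.1) _ y hy
    · rw [step, dif_neg hne]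
      exact ⟨h1, h2, Or.inr (Finset.not_nonempty_iff_eq_empty.1 hne)⟩

theorem p2l_fst (L : List Z → Dec) (φ : Dec → Z → Prop) (ord : Dec → LinearOrder Z)
    (h₀ : Dec) (D : List Z) :
    (p2l L φ ord h₀ D).1 = decision L h₀ (p2l L φ ord h₀ D).2 :=
  (iterate_step L φ ord h₀ D D.length).1

theorem selects_p2l (L : List Z → Dec) (φ : Dec → Z → Prop) (ord : Dec → LinearOrder Z)
    (h₀ : Dec) (D : List Z) : Selects L φ ord h₀ D (p2l L φ ord h₀ D).2 := by
  classical
  obtain ⟨h1, h2, h3⟩ := iterate_step L φ ord h₀ D D.length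
  refine ⟨h2, ?_⟩
  rcases h3 with h3 | h3
  -- after `|D|` appended elements the list is a permutation of `D` and nothing remains
  · have hperm := h2.subperm.perm_of_length_le h3.ge
    rw [Finset.eq_empty_iff_forall_notMem]
    intro z hz
    have := (mem_unsatisfied.1 hz).1
    rw [show (p2l L φ ord h₀ D).2 = ((step L φ ord D)^[D.length] (h₀, [])).2 from rfl,
      hperm.count_eq] at this
    exact lt_irrefl _ this
  · rw [h1] at h3
    exact h3

theorem Selects.unique {D T T' : List Z} (hT : Selects L φ ord h₀ D T)
    (hT' : Selects L φ ord h₀ D T') : T = T' := by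
  have key : ∀ i, i ≤ T.length → i ≤ T'.length → T.take i = T'.take i := by
    intro i
    induction i with
    | zero => simp
    | succ i ih =>
      intro hi hi'
      have h := ih (by omega) (by omega)
      obtain ⟨h1, h2⟩ := hT.1 i hi
      obtain ⟨h1', h2'⟩ := hT'.1 i hi'
      rw [← h] at h1' h2'
      have := (ord (decision L h₀ (T.take i))).le_antisymm _ _ (h2' _ h1) (h2 _ h1')
      rw [← List.take_append_getElem hi, ← List.take_append_getElem hi', h, this]
  rcases lt_trichotomy T.length T'.length with h | h | h
  · have h1 := (hT'.1 _ h).1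
    rw [← key _ le_rfl h.le, List.take_length, hT.2] at h1
    simp at h1
  · have := key _ le_rfl h.le
    rwa [List.take_length, h, List.take_length] at this
  · have h1 := (hT.1 _ h).1
    rw [key _ h.le le_rfl, List.take_length, hT'.2] at h1
    simp at h1

theorem p2l_snd_eq_iff {D T : List Z} :
    (p2l L φ ord h₀ D).2 = T ↔ Selects L φ ord h₀ D T :=
  ⟨fun h => h ▸ selects_p2l L φ ord h₀ D, fun h => (selects_p2l L φ ord h₀ D).unique h⟩

theorem p2l_snd_subperm (D : List Z) : (p2l L φ ord h₀ D).2.Subperm D :=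
  (selects_p2l L φ ord h₀ D).1.subperm

theorem unsatisfied_perm {D D' : List Z} (hD : D.Perm D') (h : Dec) (T : List Z) :
    unsatisfied φ D h T = unsatisfied φ D' h T := by
  classical
  ext z
  rw [mem_unsatisfied, mem_unsatisfied, hD.count_eq]

theorem p2l_snd_perm {D D' : List Z} (hD : D.Perm D') :
    (p2l L φ ord h₀ D).2 = (p2l L φ ord h₀ D').2 := by
  rw [p2l_snd_eq_iff]
  have h := selects_p2l L φ ord h₀ D'
  unfold Selects IsGreedy at h ⊢
  simpa only [unsatisfied_perm hD] using h

/-- The compression is preferent: if the selected list survives the removal of a data point, it is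
selected from the smaller sample as well; and the point removed satisfies the property, since
otherwise the loop would not have stopped. -/
theorem p2l_snd_of_append {D T : List Z} {z : Z} (hTD : T.Subperm D)
    (hT : (p2l L φ ord h₀ (D ++ [z])).2 = T) :
    (p2l L φ ord h₀ D).2 = T ∧ φ (decision L h₀ T) z := by
  classical
  rw [p2l_snd_eq_iff] at hT ⊢
  rw [List.subperm_iff_count] at hTD
  have hmono : ∀ h T' , unsatisfied φ D h T' ⊆ unsatisfied φ (D ++ [z]) h T' := by
    intro h T' y hy
    rw [mem_unsatisfied] at hy ⊢
    refine ⟨hy.1.trans_le ?_, hy.2⟩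
    rw [List.count_append]
    omega
  refine ⟨⟨fun i hi => ⟨?_, fun y hy => (hT.1 i hi).2 y (hmono _ _ hy)⟩, ?_⟩, ?_⟩
  · rw [mem_unsatisfied]
    refine ⟨?_, (mem_unsatisfied.1 (hT.1 i hi).1).2⟩
    have h1 := hTD T[i]
    have h2 : (T.take (i + 1)).count T[i] ≤ T.count T[i] :=
      (List.take_sublist _ _).count_le _
    rw [← List.take_append_getElem hi, List.count_append, List.count_singleton_self] at h2
    omega
  · have := hmono (decision L h₀ T) T
    rwa [hT.2, Finset.subset_empty] at this
  · by_contra hz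
    have hmem : z ∈ unsatisfied φ (D ++ [z]) (decision L h₀ T) T := by
      rw [mem_unsatisfied]
      refine ⟨?_, hz⟩
      rw [List.count_append, List.count_singleton_self]
      exact Nat.lt_succ_of_le (hTD z)
    rw [hT.2] at hmem
    simp at hmem

end Loop

/-! ### The compression on tuples of data points -/

section Selection

variable {Z Dec : Type*} (L : List Z → Dec) (φ : Dec → Z → Prop) (ord : Dec → LinearOrder Z)
  (h₀ : Dec)

/-- The list that P2L selects from the sample `x`. -/
noncomputable def selected {m : ℕ} (x : Fin m → Z) : List Z :=
  (p2l L φ ord h₀ (List.ofFn x)).2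

theorem exists_selected_eq {m k : ℕ} {x : Fin m → Z} (hk : (selected L φ ord h₀ x).length = k) :
    ∃ j : Fin k ↪ Fin m, selected L φ ord h₀ x = List.ofFn (x ∘ j) := by
  classical
  subst hk
  have h : (selected L φ ord h₀ x).Subperm (List.ofFn x) := p2l_snd_subperm _
  refine ⟨⟨fun i => Fin.cast (by simp) (h.idxInj i), fun a b hab => ?_⟩, ?_⟩
  · exact h.idxInj_injective (Fin.cast_injective _ hab)
  · apply List.ext_getElem
    · simp
    · intro i h1 h2
      have := (h.getElem_idxInj_eq_getElem (i := ⟨i, h1⟩)).symm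
      rw [List.getElem_ofFn] at this
      rw [List.getElem_ofFn]
      exact this

theorem length_selected_le {m : ℕ} (x : Fin m → Z) : (selected L φ ord h₀ x).length ≤ m := by
  have h : (selected L φ ord h₀ x).Subperm (List.ofFn x) := p2l_snd_subperm _
  simpa using h.length_le

theorem selected_comp_perm {m : ℕ} (x : Fin m → Z) (σ : Equiv.Perm (Fin m)) :
    selected L φ ord h₀ (x ∘ σ) = selected L φ ord h₀ x :=
  p2l_snd_perm (σ.ofFn_comp_perm x)

open Classical in
/-- The number of ways to place the `k` selected points among the `m` positions of the sample. It
exceeds `1` only if data points are repeated. -/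
noncomputable def placements {m : ℕ} (k : ℕ) (x : Fin m → Z) : ℕ :=
  (Finset.univ.filter fun j : Fin k ↪ Fin m =>
    selected L φ ord h₀ x = List.ofFn (x ∘ j)).card

theorem placements_comp_perm {m k : ℕ} (x : Fin m → Z) (σ : Equiv.Perm (Fin m)) :
    placements L φ ord h₀ k (x ∘ σ) = placements L φ ord h₀ k x := by
  classical
  unfold placements
  rw [selected_comp_perm]
  apply Finset.card_bij (fun j _ => j.trans σ.toEmbedding)
  · intro j hj
    simpa [Function.comp_def] using hj
  · intro j _ j' _ h
    refine DFunLike.ext _ _ fun i => ?_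
    have := DFunLike.congr_fun h i
    simpa using this
  · intro j hj
    refine ⟨j.trans σ.symm.toEmbedding, ?_, ?_⟩
    · simpa [Function.comp_def] using hj
    · ext i
      simp

/-- Preference for samples: if the first `k` points of a sample are selected, then they are selected
after the last point is dropped, and that point satisfies the property. -/
theorem selected_init {k d : ℕ} {x : Fin (k + (d + 1)) → Z}
    (hx : selected L φ ord h₀ x = List.ofFn (x ∘ Fin.castAdd (d + 1))) :
    selected L φ ord h₀ (Fin.init (n := k + d) x)
        = List.ofFn (Fin.init (n := k + d) x ∘ Fin.castAdd d) ∧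
      φ (decision L h₀ (List.ofFn (Fin.init (n := k + d) x ∘ Fin.castAdd d)))
        (x (Fin.last (k + d))) := by
  apply p2l_snd_of_append
  · rw [List.ofFn_add (f := Fin.init (n := k + d) x)]
    exact (List.sublist_append_left _ _).subperm
  · have h : List.ofFn (Fin.init (n := k + d) x) ++ [x (Fin.last (k + d))] = List.ofFn x := by
      rw [List.ofFn_succ' (n := k + d) (f := x), List.concat_eq_append]
      rfl
    rw [h]
    exact hx

theorem placements_init_le {k d : ℕ} {x : Fin (k + (d + 1)) → Z}
    (hx : selected L φ ord h₀ x = List.ofFn (x ∘ Fin.castAdd (d + 1))) :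
    placements L φ ord h₀ k (Fin.init (n := k + d) x) ≤ placements L φ ord h₀ k x := by
  classical
  unfold placements
  have h := (selected_init L φ ord h₀ hx).1
  apply Finset.card_le_card_of_injOn (fun j => j.trans (Fin.castSuccEmb (n := k + d)))
  · intro j hj
    simp only [Finset.coe_filter, Finset.mem_univ, true_and, Set.mem_ofPred_eq] at hj ⊢
    rw [hx]
    rw [h] at hj
    exact hj
  · intro j _ j' _ hjj
    ext i
    have := DFunLike.congr_fun hjj i
    simpa [Fin.ext_iff] using this

end Selection

/-! ### The selection measures -/

section SelectionMeasure

variable {Z Dec : Type*} [MeasurableSpace Z] (L : List Z → Dec) (φ : Dec → Z → Prop)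
  (ord : Dec → LinearOrder Z) (h₀ : Dec) (Pz : Measure Z)

/-- The indicator that the first `k` of `k + d` data points are selected, divided by the number of
placements so that ties between equal data points are not counted more than once. -/
noncomputable def selectionWeight (k d : ℕ) (x : Fin (k + d) → Z) : ENNReal :=
  open Classical in
  if selected L φ ord h₀ x = List.ofFn (x ∘ Fin.castAdd d) then
    (placements L φ ord h₀ k x : ENNReal)⁻¹ else 0

/-- The law of the first `k` points of a sample of size `k + d`, on the event that they are the
selected ones (with weights that account for ties). -/
noncomputable def selectionMeasure (k d : ℕ) : Measure (Fin k → Z) :=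
  ((Measure.pi fun _ : Fin (k + d) => Pz).withDensity (selectionWeight L φ ord h₀ k d)).map
    fun x => x ∘ Fin.castAdd d

variable {L φ ord h₀ Pz}

theorem measurable_placements {m k : ℕ}
    (hE : ∀ j : Fin k ↪ Fin m,
      MeasurableSet {x : Fin m → Z | selected L φ ord h₀ x = List.ofFn (x ∘ j)}) :
    Measurable fun x : Fin m → Z => (placements L φ ord h₀ k x : ENNReal) := by
  classical
  have h : (fun x : Fin m → Z => (placements L φ ord h₀ k x : ENNReal)) = fun x =>
      ∑ j : Fin k ↪ Fin m,
        if selected L φ ord h₀ x = List.ofFn (x ∘ j) then (1 : ENNReal) else 0 := by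
    funext x
    rw [placements, Finset.sum_boole]
  rw [h]
  exact Finset.measurable_sum _ fun j _ => Measurable.ite (hE j) measurable_const measurable_const

theorem measurable_selectionWeight {k d : ℕ}
    (hE : ∀ j : Fin k ↪ Fin (k + d),
      MeasurableSet {x : Fin (k + d) → Z | selected L φ ord h₀ x = List.ofFn (x ∘ j)}) :
    Measurable (selectionWeight L φ ord h₀ k d) := by
  classical
  unfold selectionWeight
  exact Measurable.ite (hE (Fin.castAddEmb d)) (measurable_placements hE).inv
    measurable_const

theorem measurable_comp_index {m k : ℕ} (j : Fin k → Fin m) :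
    Measurable fun x : Fin m → Z => x ∘ j :=
  measurable_pi_lambda _ fun i => measurable_pi_apply (j i)

theorem lintegral_selectionMeasure {k d : ℕ}
    (hE : ∀ j : Fin k ↪ Fin (k + d),
      MeasurableSet {x : Fin (k + d) → Z | selected L φ ord h₀ x = List.ofFn (x ∘ j)})
    {g : (Fin k → Z) → ENNReal} (hg : Measurable g) :
    ∫⁻ τ, g τ ∂selectionMeasure L φ ord h₀ Pz k d
      = ∫⁻ x, selectionWeight L φ ord h₀ k d x * g (x ∘ Fin.castAdd d)
          ∂Measure.pi fun _ : Fin (k + d) => Pz := by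
  rw [selectionMeasure, lintegral_map hg (measurable_comp_index _),
    lintegral_withDensity_eq_lintegral_mul _ (measurable_selectionWeight hE)
      (g := fun x => g (x ∘ Fin.castAdd d)) (hg.comp (measurable_comp_index _))]
  rfl

/-- By exchangeability every placement of the selected points contributes the same mass. -/
theorem measure_selected_mem [IsProbabilityMeasure Pz] {k d : ℕ}
    (hE : ∀ j : Fin k ↪ Fin (k + d),
      MeasurableSet {x : Fin (k + d) → Z | selected L φ ord h₀ x = List.ofFn (x ∘ j)})
    {B : Set (Fin k → Z)} (hB : MeasurableSet B) :
    (Measure.pi fun _ : Fin (k + d) => Pz)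
        {x | ∃ τ ∈ B, selected L φ ord h₀ x = List.ofFn τ}
      = (k + d).descFactorial k * selectionMeasure L φ ord h₀ Pz k d B := by
  classical
  set μ := Measure.pi fun _ : Fin (k + d) => Pz
  let F : (Fin k ↪ Fin (k + d)) → (Fin (k + d) → Z) → ENNReal := fun j x =>
    if selected L φ ord h₀ x = List.ofFn (x ∘ j) then
      (placements L φ ord h₀ k x : ENNReal)⁻¹ * B.indicator 1 (x ∘ j) else 0
  have hind : Measurable (B.indicator (1 : (Fin k → Z) → ENNReal)) :=
    measurable_one.indicator hB
  have hF : ∀ j, Measurable (F j) := fun j =>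
    Measurable.ite (hE j) ((measurable_placements hE).inv.mul
      (hind.comp (measurable_comp_index _))) measurable_const
  set E : Set (Fin (k + d) → Z) := {x | ∃ τ ∈ B, selected L φ ord h₀ x = List.ofFn τ} with hE'
  have hset : MeasurableSet E := by
    have : E = ⋃ j : Fin k ↪ Fin (k + d),
          {x | selected L φ ord h₀ x = List.ofFn (x ∘ j)} ∩ (fun x => x ∘ j) ⁻¹' B := by
      ext x
      simp only [hE', Set.mem_ofPred_eq, Set.mem_iUnion, Set.mem_inter_iff, Set.mem_preimage]
      constructor
      · rintro ⟨τ, hτ, h⟩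
        obtain ⟨j, hj⟩ := exists_selected_eq L φ ord h₀ (x := x) (k := k) (by rw [h]; simp)
        refine ⟨j, hj, ?_⟩
        rwa [← List.ofFn_injective (h.symm.trans hj)]
      · rintro ⟨j, hj, h⟩
        exact ⟨_, h, hj⟩
    rw [this]
    exact MeasurableSet.iUnion fun j => (hE j).inter (measurable_comp_index _ hB)
  -- the weights of the placements of one sample sum up to one
  have hsum : ∀ x, E.indicator (1 : (Fin (k + d) → Z) → ENNReal) x = ∑ j, F j x := by
    intro x
    by_cases hlen : (selected L φ ord h₀ x).length = k
    · obtain ⟨j₀, hj₀⟩ := exists_selected_eq L φ ord h₀ hlen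
      have hFj : ∀ j, F j x = if selected L φ ord h₀ x = List.ofFn (x ∘ j) then
          (placements L φ ord h₀ k x : ENNReal)⁻¹ * B.indicator 1 (x ∘ j₀) else 0 := by
        intro j
        by_cases h : selected L φ ord h₀ x = List.ofFn (x ∘ j)
        · simp only [F]
          rw [if_pos h, if_pos h, List.ofFn_injective (hj₀.symm.trans h)]
        · simp only [F]
          rw [if_neg h, if_neg h]
      have hne : (placements L φ ord h₀ k x : ENNReal) ≠ 0 := by
        rw [Nat.cast_ne_zero, placements]
        exact Finset.card_ne_zero.2 ⟨j₀, by simpa using hj₀⟩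
      simp_rw [hFj]
      rw [← Finset.sum_filter, Finset.sum_const, nsmul_eq_mul]
      rw [show ((Finset.univ.filter fun j : Fin k ↪ Fin (k + d) =>
          selected L φ ord h₀ x = List.ofFn (x ∘ j)).card : ENNReal)
          = placements L φ ord h₀ k x from rfl, ← mul_assoc,
        ENNReal.mul_inv_cancel hne (ENNReal.natCast_ne_top _), one_mul]
      have hiff : x ∈ E ↔ x ∘ j₀ ∈ B := by
        constructor
        · rintro ⟨τ, hτ, h⟩
          rwa [← List.ofFn_injective (h.symm.trans hj₀)]
        · intro h
          exact ⟨_, h, hj₀⟩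
      by_cases h : x ∘ j₀ ∈ B
      · rw [Set.indicator_of_mem (hiff.2 h), Set.indicator_of_mem h, Pi.one_apply, Pi.one_apply]
      · rw [Set.indicator_of_notMem (mt hiff.1 h), Set.indicator_of_notMem h]
    · rw [Set.indicator_of_notMem]
      · symm
        apply Finset.sum_eq_zero
        intro j _
        simp only [F]
        rw [if_neg]
        intro h
        exact hlen (by rw [h]; simp)
      · rintro ⟨τ, _, h⟩
        exact hlen (by rw [h]; simp)
  have hone : ∀ j, ∫⁻ x, F j x ∂μ = selectionMeasure L φ ord h₀ Pz k d B := by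
    intro j
    -- a permutation of the sample moves the placement `j` to the first `k` positions
    obtain ⟨σ, hσ⟩ := Equiv.Perm.exists_extending_pair (Fin.castAdd (m := d) : Fin k → _) j
      (Fin.castAdd_injective k d) j.injective
    have hσ' : ∀ x : Fin (k + d) → Z, (x ∘ σ) ∘ Fin.castAdd d = x ∘ j := by
      intro x
      funext i
      simp [hσ]
    have hmp : MeasurePreserving (fun x : Fin (k + d) → Z => x ∘ σ) μ μ := by
      have h := (measurePreserving_piCongrLeft (fun _ : Fin (k + d) => Pz) σ).symm
      convert h using 1
      rfl
    rw [← lintegral_indicator_one hB, lintegral_selectionMeasure hE hind,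
      ← hmp.lintegral_comp (f := fun x => selectionWeight L φ ord h₀ k d x *
        B.indicator 1 (x ∘ Fin.castAdd d)) ((measurable_selectionWeight hE).mul
        (hind.comp (measurable_comp_index _)))]
    apply lintegral_congr
    intro x
    simp only [F, selectionWeight]
    rw [selected_comp_perm, placements_comp_perm, hσ']
    split_ifs <;> simp
  rw [← lintegral_indicator_one hset, lintegral_congr hsum, lintegral_finsetSum _ fun j _ => hF j,
    Finset.sum_congr rfl fun j _ => hone j, Finset.sum_const, Finset.card_univ,
    Fintype.card_embedding_eq, nsmul_eq_mul, Fintype.card_fin, Fintype.card_fin]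

end SelectionMeasure

section Bound

variable {Z Dec : Type*} [MeasurableSpace Z] {L : List Z → Dec} {φ : Dec → Z → Prop}
  {ord : Dec → LinearOrder Z} {h₀ : Dec} {Pz : Measure Z}

/-- Each additional data point has to satisfy the property for the selection to persist, which
contributes a factor `Pz {φ}` to the density. -/
theorem lintegral_selectionMeasure_succ_le [IsProbabilityMeasure Pz] {k d : ℕ}
    (hE : ∀ (m : ℕ) (j : Fin k ↪ Fin m),
      MeasurableSet {x : Fin m → Z | selected L φ ord h₀ x = List.ofFn (x ∘ j)})
    (hV : MeasurableSet {p : (Fin k → Z) × Z | φ (decision L h₀ (List.ofFn p.1)) p.2})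
    {g : (Fin k → Z) → ENNReal} (hg : Measurable g) :
    ∫⁻ τ, g τ ∂selectionMeasure L φ ord h₀ Pz k (d + 1) ≤
      ∫⁻ τ, g τ * Pz {z | φ (decision L h₀ (List.ofFn τ)) z}
        ∂selectionMeasure L φ ord h₀ Pz k d := by
  classical
  have hq : Measurable fun τ : Fin k → Z => Pz {z | φ (decision L h₀ (List.ofFn τ)) z} :=
    measurable_measure_prodMk_left hV
  rw [lintegral_selectionMeasure (hE _) hg, lintegral_selectionMeasure (hE _)
    (g := fun τ => g τ * Pz {z | φ (decision L h₀ (List.ofFn τ)) z}) (hg.mul hq)]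
  let V : Set ((Fin k → Z) × Z) := {p | φ (decision L h₀ (List.ofFn p.1)) p.2}
  let F : Z × (Fin (k + d) → Z) → ENNReal := fun p =>
    selectionWeight L φ ord h₀ k d p.2 * g (p.2 ∘ Fin.castAdd d) *
      V.indicator 1 (p.2 ∘ Fin.castAdd d, p.1)
  have hind : Measurable (V.indicator (1 : (Fin k → Z) × Z → ENNReal)) :=
    measurable_one.indicator hV
  have hw := measurable_selectionWeight (d := d) (hE _)
  have hF : Measurable F := by
    refine Measurable.mul (Measurable.mul (hw.comp measurable_snd)
      (hg.comp ((measurable_comp_index _).comp measurable_snd))) (hind.comp ?_)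
    exact ((measurable_comp_index _).comp measurable_snd).prodMk measurable_fst
  have hmp := measurePreserving_piFinSuccAbove (fun _ : Fin (k + d + 1) => Pz) (Fin.last (k + d))
  calc _ ≤ ∫⁻ x, F (MeasurableEquiv.piFinSuccAbove (fun _ => Z) (Fin.last (k + d)) x)
        ∂Measure.pi fun _ : Fin (k + d + 1) => Pz := by
        apply lintegral_mono
        intro x
        have hx : MeasurableEquiv.piFinSuccAbove (fun _ => Z) (Fin.last (k + d)) x
            = (x (Fin.last (k + d)), Fin.init (n := k + d) x) :=
          Prod.ext rfl (Fin.removeNth_last x)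
        simp only [hx, F]
        by_cases h : selected L φ ord h₀ x = List.ofFn (x ∘ Fin.castAdd (d + 1))
        · obtain ⟨h1, h2⟩ := selected_init L φ ord h₀ h
          have hmem : (Fin.init (n := k + d) x ∘ Fin.castAdd d, x (Fin.last (k + d))) ∈ V := h2
          rw [Set.indicator_of_mem hmem, Pi.one_apply, mul_one, selectionWeight, selectionWeight,
            if_pos h1]
          refine mul_le_mul' ?_ le_rfl
          refine (if_pos h).trans_le ?_
          apply ENNReal.inv_le_inv.2
          exact_mod_cast placements_init_le L φ ord h₀ h
        · refine (le_of_eq ?_).trans zero_le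
          rw [selectionWeight]
          exact (congrArg (· * _) (if_neg h)).trans (zero_mul _)
    _ = ∫⁻ p, F p ∂Pz.prod (Measure.pi fun _ : Fin (k + d) => Pz) := hmp.lintegral_comp hF
    _ = ∫⁻ y, ∫⁻ z, F (z, y) ∂Pz ∂Measure.pi fun _ : Fin (k + d) => Pz :=
        lintegral_prod_symm _ hF.aemeasurable
    _ = _ := by
        apply lintegral_congr
        intro y
        have hVy : MeasurableSet {z | φ (decision L h₀ (List.ofFn (y ∘ Fin.castAdd d))) z} :=
          measurable_prodMk_left hV
        simp only [F]
        rw [lintegral_const_mul _ (f := fun z => V.indicator 1 (y ∘ Fin.castAdd d, z))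
          (hind.comp measurable_prodMk_left), mul_assoc,
          ← lintegral_indicator_one hVy]
        rfl

theorem lintegral_selectionMeasure_add_le [IsProbabilityMeasure Pz] {k : ℕ}
    (hE : ∀ (m : ℕ) (j : Fin k ↪ Fin m),
      MeasurableSet {x : Fin m → Z | selected L φ ord h₀ x = List.ofFn (x ∘ j)})
    (hV : MeasurableSet {p : (Fin k → Z) × Z | φ (decision L h₀ (List.ofFn p.1)) p.2})
    (d e : ℕ) {g : (Fin k → Z) → ENNReal} (hg : Measurable g) :
    ∫⁻ τ, g τ ∂selectionMeasure L φ ord h₀ Pz k (d + e) ≤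
      ∫⁻ τ, g τ * Pz {z | φ (decision L h₀ (List.ofFn τ)) z} ^ e
        ∂selectionMeasure L φ ord h₀ Pz k d := by
  have hq : Measurable fun τ : Fin k → Z => Pz {z | φ (decision L h₀ (List.ofFn τ)) z} :=
    measurable_measure_prodMk_left hV
  induction e generalizing g with
  | zero => simp
  | succ e ih =>
    refine (lintegral_selectionMeasure_succ_le (d := d + e) hE hV hg).trans ?_
    refine (ih (hg.mul hq)).trans (le_of_eq ?_)
    simp only [Pi.mul_apply, mul_assoc, pow_succ']

/-- Where the weights of the smaller sample sizes, divided by the probability that the additional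
points satisfy the property, add up to at least the weight of the full sample, the probability that
the selected list has length `k` and lies in `B` is bounded by the average of the probabilities of
length `k` over the smaller sample sizes. -/
theorem measure_selected_mem_le [IsProbabilityMeasure Pz] {k e : ℕ}
    (hE : ∀ (m : ℕ) (j : Fin k ↪ Fin m),
      MeasurableSet {x : Fin m → Z | selected L φ ord h₀ x = List.ofFn (x ∘ j)})
    (hV : MeasurableSet {p : (Fin k → Z) × Z | φ (decision L h₀ (List.ofFn p.1)) p.2})
    {B : Set (Fin k → Z)} (hB : MeasurableSet B) (c : ENNReal)
    (hBc : ∀ τ ∈ B, ((k + e).choose k : ENNReal) ≤ ∑ d ∈ Finset.range e,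
      c * (k + d).choose k * (Pz {z | φ (decision L h₀ (List.ofFn τ)) z} ^ (e - d))⁻¹) :
    (Measure.pi fun _ : Fin (k + e) => Pz)
        {x | ∃ τ ∈ B, selected L φ ord h₀ x = List.ofFn τ} ≤
      ∑ d ∈ Finset.range e, c * (Measure.pi fun _ : Fin (k + d) => Pz)
        {x | (selected L φ ord h₀ x).length = k} := by
  set q : (Fin k → Z) → ENNReal := fun τ => Pz {z | φ (decision L h₀ (List.ofFn τ)) z}
  have hq : Measurable q := measurable_measure_prodMk_left hV
  have hind : Measurable (B.indicator (1 : (Fin k → Z) → ENNReal)) :=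
    measurable_one.indicator hB
  let g : ℕ → (Fin k → Z) → ENNReal := fun d τ => B.indicator 1 τ * (q τ ^ (e - d))⁻¹
  have hg : ∀ d, Measurable (g d) := fun d => hind.mul (hq.pow_const _).inv
  have hstep : ∀ d ∈ Finset.range e, ∫⁻ τ, g d τ ∂selectionMeasure L φ ord h₀ Pz k e ≤
      selectionMeasure L φ ord h₀ Pz k d B := by
    intro d hd
    rw [Finset.mem_range] at hd
    have h := lintegral_selectionMeasure_add_le (Pz := Pz) hE hV d (e - d) (hg d)
    rw [Nat.add_sub_cancel' hd.le] at h
    rw [← lintegral_indicator_one hB]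
    refine h.trans (lintegral_mono fun τ => ?_)
    simp only [g]
    rw [mul_assoc]
    exact mul_le_of_le_one_right' (ENNReal.inv_mul_le_one _)
  have hmass : ((k + e).choose k : ENNReal) * selectionMeasure L φ ord h₀ Pz k e B ≤
      ∑ d ∈ Finset.range e,
        c * ((k + d).choose k * selectionMeasure L φ ord h₀ Pz k d B) := by
    calc _ = ∫⁻ τ, ((k + e).choose k : ENNReal) * B.indicator 1 τ
          ∂selectionMeasure L φ ord h₀ Pz k e := by
          rw [lintegral_const_mul _ hind, lintegral_indicator_one hB]
      _ ≤ ∫⁻ τ, ∑ d ∈ Finset.range e, c * (k + d).choose k * g d τ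
          ∂selectionMeasure L φ ord h₀ Pz k e := by
          apply lintegral_mono
          intro τ
          by_cases hτ : τ ∈ B
          · simpa [g, hτ] using hBc τ hτ
          · simp [hτ]
      _ = ∑ d ∈ Finset.range e,
            c * (k + d).choose k * ∫⁻ τ, g d τ ∂selectionMeasure L φ ord h₀ Pz k e := by
          rw [lintegral_finsetSum _ fun d _ => (hg d).const_mul _]
          exact Finset.sum_congr rfl fun d _ => lintegral_const_mul _ (hg d)
      _ ≤ _ := by
          apply Finset.sum_le_sum
          intro d hd
          rw [mul_assoc]
          gcongr
          exact hstep d hd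
  rw [measure_selected_mem (hE _) hB, Nat.descFactorial_eq_factorial_mul_choose, Nat.cast_mul,
    mul_assoc]
  calc _ ≤ (k.factorial : ENNReal) * ∑ d ∈ Finset.range e,
          c * ((k + d).choose k * selectionMeasure L φ ord h₀ Pz k d B) := by gcongr
    _ = ∑ d ∈ Finset.range e,
          c * ((k + d).descFactorial k * selectionMeasure L φ ord h₀ Pz k d B) := by
        rw [Finset.mul_sum]
        apply Finset.sum_congr rfl
        intro d _
        rw [Nat.descFactorial_eq_factorial_mul_choose, Nat.cast_mul]
        ring
    _ ≤ _ := by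
        apply Finset.sum_le_sum
        intro d _
        rw [← measure_selected_mem (hE _) hB]
        gcongr
        rintro ⟨τ, _, h⟩
        rw [h, List.length_ofFn]

/-! ### The risk threshold -/

theorem epsBar_spec {k n : ℕ} {δ : ℝ} (h : k < n ∧ 0 < δ ∧ δ < 1) :
    epsBar k δ n ∈ Set.Icc ((k : ℝ) / n) 1 ∧ Psi k δ n (epsBar k δ n) = 1 := by
  rw [epsBar, dif_pos h]
  exact (existsUnique_Psi h).choose_spec.1

/-- Above the threshold `Ψ` is at least one. In `ℝ≥0∞`, where `0⁻¹ = ∞`, this includes the risk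
`1`, that is, `q = 0`. -/
theorem choose_le_of_epsBar_lt {k e : ℕ} (he : 0 < e) {δ : ℝ} (hδ0 : 0 < δ) (hδ1 : δ < 1)
    {q : ENNReal} (hq : q.toReal < 1 - epsBar k δ (k + e)) (hqt : q ≠ ⊤) :
    ((k + e).choose k : ENNReal) ≤ ∑ d ∈ Finset.range e,
      ENNReal.ofReal (δ / (k + e : ℕ)) * (k + d).choose k * (q ^ (e - d))⁻¹ := by
  have hn : (0 : ℝ) < (k + e : ℕ) := by exact_mod_cast (by omega : 0 < k + e)
  rcases eq_or_ne q 0 with rfl | hq0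
  -- if `q = 0`, already the summand `d = 0` is infinite
  · refine le_top.trans ?_
    rw [top_le_iff]
    apply ENNReal.sum_eq_top.2
    refine ⟨0, Finset.mem_range.2 he, ?_⟩
    rw [Nat.sub_zero, zero_pow he.ne', ENNReal.inv_zero]
    apply ENNReal.mul_top
    simp only [add_zero, Nat.choose_self, Nat.cast_one, mul_one, ne_eq, ENNReal.ofReal_eq_zero,
      not_le]
    positivity
  · obtain ⟨⟨hε0, hε1⟩, hΨ⟩ := epsBar_spec (k := k) (n := k + e) (δ := δ) ⟨by omega, hδ0, hδ1⟩
    set ε := epsBar k δ (k + e)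
    have hr : 0 < q.toReal := ENNReal.toReal_pos hq0 hqt
    have hC : (0 : ℝ) < (k + e).choose k := by exact_mod_cast Nat.choose_pos (by omega)
    have hterm : ∀ d ∈ Finset.range e,
        ENNReal.ofReal (δ / (k + e : ℕ)) * (k + d).choose k * (q ^ (e - d))⁻¹
        = ENNReal.ofReal (δ / (k + e : ℕ) * (k + d).choose k * (q.toReal ^ (e - d))⁻¹) := by
      intro d _
      rw [ENNReal.ofReal_mul (by positivity), ENNReal.ofReal_mul (by positivity),
        ENNReal.ofReal_natCast, ENNReal.ofReal_inv_of_pos (by positivity),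
        ENNReal.ofReal_pow hr.le, ENNReal.ofReal_toReal hqt]
    rw [Finset.sum_congr rfl hterm, ← ENNReal.ofReal_sum_of_nonneg (fun d _ => by positivity),
      ← ENNReal.ofReal_natCast]
    apply ENNReal.ofReal_le_ofReal
    rw [Psi, Finset.sum_Ico_eq_sum_range, Nat.add_sub_cancel_left, Finset.mul_sum] at hΨ
    calc ((k + e).choose k : ℝ) = (k + e).choose k * 1 := (mul_one _).symm
      _ ≤ _ := by
        rw [← hΨ, Finset.mul_sum]
        apply Finset.sum_le_sum
        intro d hd
        rw [Finset.mem_range] at hd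
        rw [show k + e - (k + d) = e - d by omega]
        have h1 : ((1 - ε) ^ (e - d))⁻¹ ≤ (q.toReal ^ (e - d))⁻¹ := by
          apply inv_anti₀ (by positivity)
          exact pow_le_pow_left₀ hr.le hq.le _
        calc _ = δ / (k + e : ℕ) * (k + d).choose k * ((1 - ε) ^ (e - d))⁻¹ := by
              field_simp
          _ ≤ _ := by gcongr

/-- The probability that the risk exceeds the threshold, for a fixed initial decision. -/
theorem measure_epsBar_lt_le [IsProbabilityMeasure Pz]
    (hE : ∀ (k m : ℕ) (j : Fin k ↪ Fin m),
      MeasurableSet {x : Fin m → Z | selected L φ ord h₀ x = List.ofFn (x ∘ j)})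
    (hV : ∀ k, MeasurableSet {p : (Fin k → Z) × Z | ¬ φ (decision L h₀ (List.ofFn p.1)) p.2})
    (n : ℕ) {δ : ℝ} (hδ0 : 0 < δ) (hδ1 : δ < 1) :
    (Measure.pi fun _ : Fin n => Pz)
      {x | epsBar (selected L φ ord h₀ x).length δ n <
        Pz.real {z | ¬ φ (decision L h₀ (selected L φ ord h₀ x)) z}} ≤ ENNReal.ofReal δ := by
  have hV' : ∀ k, MeasurableSet {p : (Fin k → Z) × Z | φ (decision L h₀ (List.ofFn p.1)) p.2} := by
    intro k
    simpa [Set.compl_ofPred] using (hV k).compl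
  let B : (k : ℕ) → Set (Fin k → Z) := fun k =>
    {τ | epsBar k δ n < Pz.real {z | ¬ φ (decision L h₀ (List.ofFn τ)) z}}
  have hB : ∀ k, MeasurableSet (B k) := fun k =>
    measurableSet_lt measurable_const (measurable_measure_prodMk_left (hV k)).ennreal_toReal
  let P : ℕ → ℕ → ENNReal := fun m k => (Measure.pi fun _ : Fin m => Pz)
    {x | (selected L φ ord h₀ x).length = k}
  have hlen : ∀ m k, MeasurableSet {x : Fin m → Z | (selected L φ ord h₀ x).length = k} := by
    intro m k
    have : {x : Fin m → Z | (selected L φ ord h₀ x).length = k}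
        = ⋃ j : Fin k ↪ Fin m, {x | selected L φ ord h₀ x = List.ofFn (x ∘ j)} := by
      ext x
      simp only [Set.mem_ofPred_eq, Set.mem_iUnion]
      exact ⟨exists_selected_eq L φ ord h₀, fun ⟨j, hj⟩ => by rw [hj, List.length_ofFn]⟩
    rw [this]
    exact MeasurableSet.iUnion fun j => hE k m j
  have hP : ∀ m, ∑ k ∈ Finset.range (m + 1), P m k ≤ 1 := by
    intro m
    rw [← measure_biUnion_finset (fun a _ b _ hab => ?_) (fun k _ => hlen m k)]
    · exact prob_le_one
    · exact Set.disjoint_left.2 fun x hx hx' => hab (hx.symm.trans hx')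
  have hsub : {x : Fin n → Z | epsBar (selected L φ ord h₀ x).length δ n <
        Pz.real {z | ¬ φ (decision L h₀ (selected L φ ord h₀ x)) z}} ⊆
      ⋃ k ∈ Finset.range n, {x | ∃ τ ∈ B k, selected L φ ord h₀ x = List.ofFn τ} := by
    intro x hx
    obtain ⟨j, hj⟩ := exists_selected_eq L φ ord h₀ (x := x) rfl
    have hx' : x ∘ j ∈ B (selected L φ ord h₀ x).length := by
      simp only [B, Set.mem_ofPred_eq]
      rw [← hj]
      exact hx
    simp only [Set.mem_iUnion, Finset.mem_range]
    refine ⟨_, (length_selected_le L φ ord h₀ x).lt_of_ne fun h => ?_, x ∘ j, hx', hj⟩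
    -- if the whole sample is selected, the threshold is `1`
    have h1 : Pz.real {z | ¬ φ (decision L h₀ (selected L φ ord h₀ x)) z} ≤ 1 := measureReal_le_one
    rw [Set.mem_ofPred_eq, h, epsBar, dif_neg (by simp)] at hx
    exact absurd hx h1.not_gt
  have hk : ∀ k ∈ Finset.range n, (Measure.pi fun _ : Fin n => Pz)
      {x | ∃ τ ∈ B k, selected L φ ord h₀ x = List.ofFn τ} ≤
      ∑ m ∈ Finset.Ico k n, ENNReal.ofReal (δ / n) * P m k := by
    intro k hk
    rw [Finset.mem_range] at hk
    obtain ⟨e, rfl⟩ := Nat.exists_eq_add_of_lt hk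
    rw [Finset.sum_Ico_eq_sum_range, add_assoc, Nat.add_sub_cancel_left]
    refine measure_selected_mem_le (hE k) (hV' k) (hB k) _ fun τ hτ => ?_
    refine choose_le_of_epsBar_lt (Nat.succ_pos e) hδ0 hδ1 ?_ (measure_ne_top _ _)
    have hτm : MeasurableSet {z | φ (decision L h₀ (List.ofFn τ)) z} :=
      measurable_prodMk_left (hV' k)
    have h1 := probReal_compl_eq_one_sub (μ := Pz) hτm
    have h2 : epsBar k δ (k + e + 1) < Pz.real {z | φ (decision L h₀ (List.ofFn τ)) z}ᶜ := hτ
    rw [h1, add_assoc] at h2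
    change Pz.real _ < _
    linarith
  calc _ ≤ ∑ k ∈ Finset.range n, ∑ m ∈ Finset.Ico k n, ENNReal.ofReal (δ / n) * P m k :=
        (measure_mono hsub).trans ((measure_biUnion_finset_le _ _).trans (Finset.sum_le_sum hk))
    -- exchange the sums: for each sample size `m` the lengths `k ≤ m` are mutually exclusive
    _ = ∑ m ∈ Finset.range n, ∑ k ∈ Finset.range (m + 1), ENNReal.ofReal (δ / n) * P m k := by
        apply Finset.sum_comm'
        intro k m
        simp only [Finset.mem_range, Finset.mem_Ico]
        omega
    _ ≤ ∑ _m ∈ Finset.range n, ENNReal.ofReal (δ / n) := by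
        apply Finset.sum_le_sum
        intro m _
        rw [← Finset.mul_sum]
        exact mul_le_of_le_one_right' (hP m)
    _ ≤ ENNReal.ofReal δ := by
        rw [Finset.sum_const, Finset.card_range, nsmul_eq_mul, ← ENNReal.ofReal_natCast,
          ← ENNReal.ofReal_mul (Nat.cast_nonneg n)]
        apply ENNReal.ofReal_le_ofReal
        rcases Nat.eq_zero_or_pos n with rfl | hn
        · simpa using hδ0.le
        · have : (n : ℝ) ≠ 0 := by exact_mod_cast hn.ne'
          rw [mul_div_cancel₀ _ this]

end Bound

/-! ### Measurability of the selection -/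

section Measurability

variable {Z Dec : Type*} {L : List Z → Dec} {φ : Dec → Z → Prop} {ord : Dec → LinearOrder Z}

open Classical in
theorem count_map_lt_count_ofFn_iff {m : ℕ} (x : Fin m → Z) {J : List (Fin m)} (hJ : J.Nodup)
    (z : Z) : (J.map x).count z < (List.ofFn x).count z ↔ ∃ l ∉ J, x l = z := by
  rw [List.ofFn_eq_map, List.count_eq_countP, List.count_eq_countP, List.countP_map,
    List.countP_map]
  constructor
  · intro h
    by_contra! hcon
    refine h.not_ge ?_
    rw [List.countP_eq_length_filter, List.countP_eq_length_filter]
    apply List.Subperm.length_le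
    apply List.subperm_of_subset ((List.nodup_finRange m).filter _)
    intro l hl
    rw [List.mem_filter] at hl ⊢
    exact ⟨by_contra fun hlJ => hcon l hlJ (by simpa using hl.2), hl.2⟩
  · rintro ⟨l, hl, rfl⟩
    have h : List.Subperm (l :: J) (List.finRange m) :=
      List.subperm_of_subset (List.nodup_cons.2 ⟨hl, hJ⟩) fun a _ => List.mem_finRange a
    have h2 := h.countP_le (p := (fun y => y == x l) ∘ x)
    rw [List.countP_cons_of_pos (by simp)] at h2
    omega

/-- The event that the points at the positions `j` are selected, in terms of the positions alone. -/
theorem selected_eq_iff {h₀ : Dec} {m k : ℕ} (x : Fin m → Z) (j : Fin k ↪ Fin m) :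
    selected L φ ord h₀ x = List.ofFn (x ∘ j) ↔
      (∀ i : Fin k,
        ¬ φ (decision L h₀ (List.ofFn (x ∘ j ∘ Fin.castLE i.is_lt.le))) (x (j i)) ∧
        ∀ l, l ∉ Set.range (j ∘ Fin.castLE i.is_lt.le) →
          ¬ φ (decision L h₀ (List.ofFn (x ∘ j ∘ Fin.castLE i.is_lt.le))) (x l) →
          (ord (decision L h₀ (List.ofFn (x ∘ j ∘ Fin.castLE i.is_lt.le)))).le (x l) (x (j i))) ∧
      ∀ l, l ∉ Set.range j → φ (decision L h₀ (List.ofFn (x ∘ j))) (x l) := by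
  classical
  have hmem : ∀ {i : ℕ} (j' : Fin i → Fin m) (_ : Function.Injective j') (h : Dec) (z : Z),
      z ∈ unsatisfied φ (List.ofFn x) h (List.ofFn (x ∘ j')) ↔
        (∃ l, l ∉ Set.range j' ∧ x l = z) ∧ ¬ φ h z := by
    intro i j' hj' h z
    rw [mem_unsatisfied, show List.ofFn (x ∘ j') = (List.ofFn j').map x from List.map_ofFn.symm,
      count_map_lt_count_ofFn_iff x (List.nodup_ofFn.2 hj')]
    simp only [List.mem_ofFn, Set.mem_range]
  have htake : ∀ i : Fin k, (List.ofFn (x ∘ j)).take i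
      = List.ofFn (x ∘ j ∘ Fin.castLE i.is_lt.le) := by
    intro i
    apply List.ext_getElem
    · simp
    · intro a h1 h2
      simp
  have hj : ∀ i : Fin k, Function.Injective (j ∘ Fin.castLE i.is_lt.le) := fun i =>
    j.injective.comp (Fin.castLE_injective _)
  rw [selected, p2l_snd_eq_iff, Selects, IsGreedy]
  apply and_congr
  · constructor
    · intro h i
      obtain ⟨h1, h2⟩ := h i (by simp)
      rw [htake, List.getElem_ofFn] at h1 h2
      refine ⟨((hmem _ (hj i) _ _).1 h1).2, fun l hl hφ => ?_⟩
      exact h2 _ ((hmem _ (hj i) _ _).2 ⟨⟨l, hl, rfl⟩, hφ⟩)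
    · intro h i hi
      have hik : i < k := by simpa using hi
      obtain ⟨h1, h2⟩ := h ⟨i, hik⟩
      rw [htake ⟨i, hik⟩, List.getElem_ofFn]
      refine ⟨(hmem _ (hj ⟨i, hik⟩) _ _).2 ⟨⟨j ⟨i, hik⟩, ?_, rfl⟩, h1⟩, ?_⟩
      · rintro ⟨a, ha⟩
        have := congrArg Fin.val (j.injective ha)
        simp only [Fin.val_castLE] at this
        exact absurd a.is_lt (by simp [this])
      · intro z hz
        obtain ⟨⟨l, hl, rfl⟩, hφ⟩ := (hmem _ (hj ⟨i, hik⟩) _ _).1 hz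
        exact h2 l hl hφ
  · rw [Finset.eq_empty_iff_forall_notMem]
    constructor
    · intro h l hl
      by_contra hφ
      exact h _ ((hmem _ j.injective _ _).2 ⟨⟨l, hl, rfl⟩, hφ⟩)
    · intro h z hz
      obtain ⟨⟨l, hl, rfl⟩, hφ⟩ := (hmem _ j.injective _ _).1 hz
      exact hφ (h l hl)

theorem decision_ofFn_succ {h₀ : Dec} {k : ℕ} (τ : Fin (k + 1) → Z) :
    decision L h₀ (List.ofFn τ) = L (List.ofFn τ) := by
  rw [List.ofFn_succ]
  rfl

variable [MeasurableSpace Z] {Y : Type*} [MeasurableSpace Y] {h₀ : Y → Dec}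

theorem measurableSet_decision_violates (hL : ∀ k, MeasurableRule φ ord L k)
    (hφ : MeasurableSet {p : Y × Z | ¬ φ (h₀ p.1) p.2}) (k : ℕ) :
    MeasurableSet
      {p : (Y × (Fin k → Z)) × Z | ¬ φ (decision L (h₀ p.1.1) (List.ofFn p.1.2)) p.2} := by
  cases k with
  | zero =>
    exact (measurable_fst.fst.prodMk measurable_snd) hφ
  | succ k =>
    convert (measurable_fst.snd.prodMk measurable_snd) (hL (k + 1)).1 using 1
    ext p
    rw [Set.mem_ofPred_eq, decision_ofFn_succ]
    rfl

theorem measurableSet_decision_le (hL : ∀ k, MeasurableRule φ ord L k)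
    (hord : MeasurableSet {p : Y × Z × Z | (ord (h₀ p.1)).le p.2.1 p.2.2}) (k : ℕ) :
    MeasurableSet {p : (Y × (Fin k → Z)) × Z × Z |
      (ord (decision L (h₀ p.1.1) (List.ofFn p.1.2))).le p.2.1 p.2.2} := by
  cases k with
  | zero =>
    exact (measurable_fst.fst.prodMk measurable_snd) hord
  | succ k =>
    convert (measurable_fst.snd.prodMk measurable_snd) (hL (k + 1)).2 using 1
    ext p
    rw [Set.mem_ofPred_eq, decision_ofFn_succ]
    rfl

theorem measurableSet_selected_eq (hL : ∀ k, MeasurableRule φ ord L k)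
    (hφ : MeasurableSet {p : Y × Z | ¬ φ (h₀ p.1) p.2})
    (hord : MeasurableSet {p : Y × Z × Z | (ord (h₀ p.1)).le p.2.1 p.2.2})
    {k m : ℕ} (j : Fin k ↪ Fin m) :
    MeasurableSet {p : Y × (Fin m → Z) |
      selected L φ ord (h₀ p.1) p.2 = List.ofFn (p.2 ∘ j)} := by
  have hx : ∀ l : Fin m, Measurable fun p : Y × (Fin m → Z) => p.2 l := fun l =>
    (measurable_pi_apply l).comp measurable_snd
  have hτ : ∀ {i : ℕ} (j' : Fin i → Fin m),
      Measurable fun p : Y × (Fin m → Z) => (p.1, p.2 ∘ j') := fun j' =>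
    measurable_fst.prodMk ((measurable_comp_index j').comp measurable_snd)
  have hV : ∀ {i : ℕ} (j' : Fin i → Fin m) (l : Fin m), MeasurableSet {p : Y × (Fin m → Z) |
      ¬ φ (decision L (h₀ p.1) (List.ofFn (p.2 ∘ j'))) (p.2 l)} := fun j' l =>
    ((hτ j').prodMk (hx l)) (measurableSet_decision_violates hL hφ _)
  have hO : ∀ {i : ℕ} (j' : Fin i → Fin m) (l l' : Fin m), MeasurableSet {p : Y × (Fin m → Z) |
      (ord (decision L (h₀ p.1) (List.ofFn (p.2 ∘ j')))).le (p.2 l) (p.2 l')} := fun j' l l' =>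
    ((hτ j').prodMk ((hx l).prodMk (hx l'))) (measurableSet_decision_le hL hord _)
  simp only [selected_eq_iff]
  refine measurableSet_setOfPred.2 (Measurable.and (Measurable.forall fun i =>
    Measurable.and (measurableSet_setOfPred.1 (hV _ _)) (Measurable.forall fun l => ?_))
    (Measurable.forall fun l => measurable_const.imp ?_))
  · exact measurable_const.imp (Measurable.imp (measurableSet_setOfPred.1 (hV _ _))
      (measurableSet_setOfPred.1 (hO _ _ _)))
  · simpa using (measurableSet_setOfPred.1 (hV j l)).not

/-- The event that the risk is at most the threshold is measurable, jointly in the sample and in a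
parameter of the initial decision. -/
theorem measurableSet_risk_le {Pz : Measure Z} [IsProbabilityMeasure Pz]
    (hL : ∀ k, MeasurableRule φ ord L k)
    (hφ : MeasurableSet {p : Y × Z | ¬ φ (h₀ p.1) p.2})
    (hord : MeasurableSet {p : Y × Z × Z | (ord (h₀ p.1)).le p.2.1 p.2.2}) (n : ℕ) (ε : ℕ → ℝ) :
    MeasurableSet {p : Y × (Fin n → Z) |
      Pz.real {z | ¬ φ (decision L (h₀ p.1) (selected L φ ord (h₀ p.1) p.2)) z} ≤
        ε (selected L φ ord (h₀ p.1) p.2).length} := by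
  have h : {p : Y × (Fin n → Z) |
      Pz.real {z | ¬ φ (decision L (h₀ p.1) (selected L φ ord (h₀ p.1) p.2)) z} ≤
        ε (selected L φ ord (h₀ p.1) p.2).length}
      = ⋃ k : ℕ, ⋃ j : Fin k ↪ Fin n,
        {p | selected L φ ord (h₀ p.1) p.2 = List.ofFn (p.2 ∘ j)} ∩
        {p | Pz.real {z | ¬ φ (decision L (h₀ p.1) (List.ofFn (p.2 ∘ j))) z} ≤ ε k} := by
    ext p
    simp only [Set.mem_ofPred_eq, Set.mem_iUnion, Set.mem_inter_iff]
    constructor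
    · intro hp
      obtain ⟨j, hj⟩ := exists_selected_eq L φ ord (h₀ p.1) (x := p.2) rfl
      refine ⟨_, j, hj, ?_⟩
      rwa [← hj]
    · rintro ⟨k, j, hj, hp⟩
      rwa [hj, List.length_ofFn]
  rw [h]
  refine MeasurableSet.iUnion fun k => MeasurableSet.iUnion fun j =>
    (measurableSet_selected_eq hL hφ hord j).inter ?_
  refine measurableSet_le ?_ measurable_const
  have hm : Measurable fun p : Y × (Fin k → Z) =>
      Pz.real {z | ¬ φ (decision L (h₀ p.1) (List.ofFn p.2)) z} :=
    (measurable_measure_prodMk_left (measurableSet_decision_violates hL hφ k)).ennreal_toReal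
  exact hm.comp (measurable_fst.prodMk ((measurable_comp_index j).comp measurable_snd))

end Measurability

/-! ### The generalization bound -/

theorem measurePreserving_castAdd_natAdd {Z : Type*} [MeasurableSpace Z] (Pz : Measure Z)
    [IsProbabilityMeasure Pz] (a b : ℕ) :
    MeasurePreserving (fun x : Fin (a + b) → Z => (x ∘ Fin.castAdd b, x ∘ Fin.natAdd a))
      (Measure.pi fun _ => Pz)
      ((Measure.pi fun _ : Fin a => Pz).prod (Measure.pi fun _ : Fin b => Pz)) :=
  (measurePreserving_sumPiEquivProdPi fun _ : Fin a ⊕ Fin b => Pz).comp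
    (measurePreserving_piCongrLeft (fun _ : Fin (a + b) => Pz) finSumFinEquiv).symm

/-- The risk bound for P2L with measurable synthesis and initialization rules. -/
theorem risk_le_epsBar {Z Dec : Type*} [MeasurableSpace Z] {L init : List Z → Dec}
    {φ : Dec → Z → Prop} {ord : Dec → LinearOrder Z} {Pz : Measure Z} [IsProbabilityMeasure Pz]
    {Ω : Type*} [MeasurableSpace Ω] {P : Measure Ω} [IsProbabilityMeasure P] {N Ni : ℕ}
    (hNi : Ni ≤ N) {z : Fin N → Ω → Z} (hz : ∀ i, Measurable (z i)) (hindep : iIndepFun z P)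
    (hlaw : ∀ i, P.map (z i) = Pz) {δ : ℝ} (hδ0 : 0 < δ) (hδ1 : δ < 1)
    (hL : ∀ k, MeasurableRule φ ord L k) (hinit : MeasurableRule φ ord init Ni) :
    MeasurableSet {ω | Pz.real
        {ζ | ¬ φ (p2lInit L φ ord init Ni (List.ofFn fun i => z i ω)).1 ζ} ≤
          epsBar (p2lInit L φ ord init Ni (List.ofFn fun i => z i ω)).2.length δ (N - Ni)} ∧
      1 - δ ≤ P.real {ω | Pz.real
        {ζ | ¬ φ (p2lInit L φ ord init Ni (List.ofFn fun i => z i ω)).1 ζ} ≤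
          epsBar (p2lInit L φ ord init Ni (List.ofFn fun i => z i ω)).2.length δ (N - Ni)} := by
  obtain ⟨n, rfl⟩ := Nat.exists_eq_add_of_le hNi
  rw [Nat.add_sub_cancel_left]
  let h₀ : (Fin Ni → Z) → Dec := fun y => init (List.ofFn y)
  let G : Set ((Fin Ni → Z) × (Fin n → Z)) := {p |
    Pz.real {ζ | ¬ φ (decision L (h₀ p.1) (selected L φ ord (h₀ p.1) p.2)) ζ} ≤
      epsBar (selected L φ ord (h₀ p.1) p.2).length δ n}
  have hG : MeasurableSet G :=
    measurableSet_risk_le hL hinit.1 hinit.2 n fun k => epsBar k δ n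
  let X : Ω → (Fin Ni → Z) × (Fin n → Z) := fun ω =>
    (fun i => z (Fin.castAdd n i) ω, fun i => z (Fin.natAdd Ni i) ω)
  have hX : MeasurePreserving X P
      ((Measure.pi fun _ : Fin Ni => Pz).prod (Measure.pi fun _ : Fin n => Pz)) := by
    have h : MeasurePreserving (fun ω i => z i ω) P (Measure.pi fun _ => Pz) := by
      refine ⟨measurable_pi_lambda _ hz, ?_⟩
      rw [(iIndepFun_iff_map_fun_eq_pi_map fun i => (hz i).aemeasurable).1 hindep]
      simp only [hlaw]
    exact (measurePreserving_castAdd_natAdd Pz Ni n).comp h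
  have hgood : {ω | Pz.real
        {ζ | ¬ φ (p2lInit L φ ord init Ni (List.ofFn fun i => z i ω)).1 ζ} ≤
          epsBar (p2lInit L φ ord init Ni (List.ofFn fun i => z i ω)).2.length δ n}
      = X ⁻¹' G := by
    ext ω
    have h : p2lInit L φ ord init Ni (List.ofFn fun i => z i ω)
        = p2l L φ ord (h₀ (X ω).1) (List.ofFn (X ω).2) := by
      rw [p2lInit, List.ofFn_add, List.take_left' (by simp), List.drop_left' (by simp)]
      rfl
    rw [Set.mem_ofPred_eq, h, p2l_fst]
    rfl
  have hbound : P (X ⁻¹' G)ᶜ ≤ ENNReal.ofReal δ := by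
    rw [← Set.preimage_compl, hX.measure_preimage hG.compl.nullMeasurableSet,
      Measure.prod_apply hG.compl]
    calc _ ≤ ∫⁻ _y, ENNReal.ofReal δ ∂Measure.pi fun _ : Fin Ni => Pz := by
          apply lintegral_mono
          intro y
          have h := measure_epsBar_lt_le (L := L) (φ := φ) (ord := ord) (h₀ := h₀ y) (Pz := Pz)
            (fun k m j => measurable_prodMk_left
              (measurableSet_selected_eq hL hinit.1 hinit.2 j))
            (fun k => (measurable_prodMk_left.comp measurable_fst |>.prodMk measurable_snd)
              (measurableSet_decision_violates hL hinit.1 k)) n hδ0 hδ1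
          refine (measure_mono fun x hx => ?_).trans h
          have hxG : (y, x) ∉ G := hx
          simp only [G, Set.mem_ofPred_eq, not_le] at hxG
          exact hxG
      _ = ENNReal.ofReal δ := by simp
  rw [hgood]
  refine ⟨hX.measurable hG, ?_⟩
  have h1 := probReal_compl_eq_one_sub (μ := P) (hX.measurable hG)
  have h2 : P.real (X ⁻¹' G)ᶜ ≤ δ := ENNReal.toReal_le_of_le_ofReal hδ0.le hbound
  linarith

/-! ### Measurability of the synthesis by abstraction -/

section Synthesis

variable {nx nu nw H : ℕ}

theorem lexOrder_le_iff (a b : Uncertainty nx nw H) :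
    lexOrder.le a b ↔
      (∃ i, (∀ j < i, a.1 j = b.1 j) ∧ a.1 i < b.1 i) ∨
      (a.1 = b.1 ∧
        ((∃ t, (∀ t' < t, a.2 t' = b.2 t') ∧
            ∃ i, (∀ j < i, a.2 t j = b.2 t j) ∧ a.2 t i < b.2 t i) ∨
          a.2 = b.2)) := by
  change lexKey a ≤ lexKey b ↔ _
  rw [lexKey, lexKey, Prod.Lex.toLex_le_toLex, le_iff_lt_or_eq]
  refine or_congr Iff.rfl (and_congr Iff.rfl (or_congr Iff.rfl ?_))
  exact ⟨fun h => h, fun h => h⟩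

theorem measurableSet_lexOrder_le {Y : Type*} [MeasurableSpace Y] :
    MeasurableSet {p : Y × Uncertainty nx nw H × Uncertainty nx nw H |
      lexOrder.le p.2.1 p.2.2} := by
  simp only [lexOrder_le_iff]
  have h1 : ∀ j, Measurable fun p : Y × Uncertainty nx nw H × Uncertainty nx nw H =>
      p.2.1.1 j := fun j => by fun_prop
  have h1' : ∀ j, Measurable fun p : Y × Uncertainty nx nw H × Uncertainty nx nw H =>
      p.2.2.1 j := fun j => by fun_prop
  have h2 : ∀ t, Measurable fun p : Y × Uncertainty nx nw H × Uncertainty nx nw H =>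
      p.2.1.2 t := fun t => by fun_prop
  have h2' : ∀ t, Measurable fun p : Y × Uncertainty nx nw H × Uncertainty nx nw H =>
      p.2.2.2 t := fun t => by fun_prop
  have h3 : ∀ t j, Measurable fun p : Y × Uncertainty nx nw H × Uncertainty nx nw H =>
      p.2.1.2 t j := fun t j => by fun_prop
  have h3' : ∀ t j, Measurable fun p : Y × Uncertainty nx nw H × Uncertainty nx nw H =>
      p.2.2.2 t j := fun t j => by fun_prop
  refine measurableSet_setOfPred.2 (Measurable.or ?_ (Measurable.and ?_ (Measurable.or ?_ ?_)))
  · exact Measurable.exists fun i => (Measurable.forall fun j => measurable_const.imp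
      (measurableSet_setOfPred.1 (measurableSet_eq_fun (h1 j) (h1' j)))).and
      (measurableSet_setOfPred.1 (measurableSet_lt (h1 i) (h1' i)))
  · exact measurableSet_setOfPred.1 (measurableSet_eq_fun (by fun_prop) (by fun_prop))
  · exact Measurable.exists fun t => (Measurable.forall fun t' => measurable_const.imp
      (measurableSet_setOfPred.1 (measurableSet_eq_fun (h2 t') (h2' t')))).and
      (Measurable.exists fun i => (Measurable.forall fun j => measurable_const.imp
        (measurableSet_setOfPred.1 (measurableSet_eq_fun (h3 t j) (h3' t j)))).and
        (measurableSet_setOfPred.1 (measurableSet_lt (h3 t i) (h3' t i))))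
  · exact measurableSet_setOfPred.1 (measurableSet_eq_fun (by fun_prop) (by fun_prop))

theorem measurable_states {f : Dynamics nx nu nw H} {π : Policy nx nu H}
    (hf : ∀ t, Measurable fun p : (Fin nx → ℝ) × (Fin nu → ℝ) × (Fin nw → ℝ) =>
      f t p.1 p.2.1 p.2.2)
    (hπ : ∀ t, Measurable (π t)) (t : ℕ) :
    Measurable fun z : Uncertainty nx nw H => states f π z t := by
  induction t with
  | zero => exact measurable_pi_lambda _ fun _ => measurable_fst
  | succ t ih =>
    have hlast : Measurable fun z : Uncertainty nx nw H => states f π z t (Fin.last t) :=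
      (measurable_pi_apply _).comp ih
    refine measurable_pi_lambda _ fun i => ?_
    induction i using Fin.lastCases with
    | last =>
      simp only [states, Fin.snoc_last]
      split_ifs with h
      · exact (hf ⟨t, h⟩).comp (hlast.prodMk (((hπ ⟨t, h⟩).comp ih).prodMk
          ((measurable_pi_apply _).comp measurable_snd)))
      · exact hlast
    | cast i =>
      simp only [states, Fin.snoc_castSucc]
      exact (measurable_pi_apply i).comp ih

theorem measurable_closedLoop {f : Dynamics nx nu nw H} {π : Policy nx nu H}
    (hf : ∀ t, Measurable fun p : (Fin nx → ℝ) × (Fin nu → ℝ) × (Fin nw → ℝ) =>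
      f t p.1 p.2.1 p.2.2)
    (hπ : ∀ t, Measurable (π t)) : Measurable (closedLoop f π) :=
  (measurable_states hf hπ H).prodMk
    (measurable_pi_lambda _ fun t => (hπ t).comp (measurable_states hf hπ t))

variable {S A : Type} {G : Discretization nx nu S A}

theorem measurable_refinePolicy [Finite S] (hcell : ∀ s, MeasurableSet (G.cell ⁻¹' {s}))
    (hctrl : ∀ a, Measurable (G.ctrl a)) (ρ : AbsPolicy S A) (t : Fin H) :
    Measurable (refinePolicy G ρ t) := by
  let _ : MeasurableSpace S := ⊤
  have hc : Measurable G.cell := measurable_to_countable' hcell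
  have hσ : Measurable fun x : Fin ((t : ℕ) + 1) → Fin nx → ℝ => fun i => G.cell (x i) :=
    measurable_pi_lambda _ fun i => hc.comp (measurable_pi_apply i)
  have hF : Measurable fun p : (Fin ((t : ℕ) + 1) → S) × (Fin nx → ℝ) =>
      G.ctrl (ρ t p.1 (pastActions ρ t p.1)) p.2 :=
    measurable_from_prod_countable_right fun σ => hctrl (ρ t σ (pastActions ρ t σ))
  exact hF.comp (hσ.prodMk (measurable_pi_apply (Fin.last (t : ℕ))))

theorem measurable_transitionCount {f : Dynamics nx nu nw H}
    (hf : ∀ t, Measurable fun p : (Fin nx → ℝ) × (Fin nu → ℝ) × (Fin nw → ℝ) =>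
      f t p.1 p.2.1 p.2.2)
    (hcell : ∀ s, MeasurableSet (G.cell ⁻¹' {s})) (k : ℕ) (s : S) (a : A) (s' : S) :
    Measurable fun x : Fin k → Uncertainty nx nw H =>
      transitionCount f G (List.ofFn x) s a s' := by
  classical
  have h : ∀ x : Fin k → Uncertainty nx nw H, transitionCount f G (List.ofFn x) s a s'
      = ∑ i : Fin k, ∑ t : Fin H,
        if G.cell (f t (G.rep s) (G.ctrl a (G.rep s)) ((x i).2 t)) = s' then 1 else 0 := by
    intro x
    rw [transitionCount, List.map_ofFn, List.sum_ofFn]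
    refine Finset.sum_congr rfl fun i _ => ?_
    rw [Function.comp_apply, Finset.card_filter]
  simp only [h]
  refine Finset.measurable_sum _ fun i _ => Finset.measurable_sum _ fun t _ => ?_
  refine Measurable.ite ?_ measurable_const measurable_const
  have hm : Measurable fun x : Fin k → Uncertainty nx nw H =>
      f t (G.rep s) (G.ctrl a (G.rep s)) ((x i).2 t) :=
    (hf t).comp (measurable_const.prodMk (measurable_const.prodMk
      ((measurable_pi_apply t).comp ((measurable_pi_apply i).snd))))
  exact hm (hcell s')

/-- The synthesis depends on the data only through the finitely many transition counts, so that the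
violations form a countable union of measurable rectangles. No regularity of the solver of the IMDP
is needed. -/
theorem measurableRule_imdpSynthesis [Finite S] [Finite A] {f : Dynamics nx nu nw H}
    {Spec : Set (Trajectory nx nu H)}
    (hf : ∀ t, Measurable fun p : (Fin nx → ℝ) × (Fin nu → ℝ) × (Fin nw → ℝ) =>
      f t p.1 p.2.1 p.2.2)
    (hSpec : MeasurableSet Spec) (hcell : ∀ s, MeasurableSet (G.cell ⁻¹' {s}))
    (hctrl : ∀ a, Measurable (G.ctrl a)) (I : IntervalRule) (solver : IMDP S A → AbsPolicy S A)
    (k : ℕ) :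
    MeasurableRule (Satisfies f Spec) (fun _ => lexOrder) (imdpSynthesis f G I solver) k := by
  refine ⟨?_, measurableSet_lexOrder_le⟩
  let count : (Fin k → Uncertainty nx nw H) → S → A → S → ℕ := fun x s a s' =>
    transitionCount f G (List.ofFn x) s a s'
  have hcount : Measurable count :=
    measurable_pi_lambda _ fun s => measurable_pi_lambda _ fun a => measurable_pi_lambda _ fun s' =>
      measurable_transitionCount hf hcell k s a s'
  let π : (S → A → S → ℕ) → Policy nx nu H := fun c => refinePolicy G (solver
    { lo := fun s a s' => I.lo (c s a s') (k * H), hi := fun s a s' => I.hi (c s a s') (k * H) })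
  have hπ : ∀ x, imdpSynthesis f G I solver (List.ofFn x) = π (count x) := by
    intro x
    simp only [imdpSynthesis, empiricalIMDP, List.length_ofFn, π, count]
  have h : {p : (Fin k → Uncertainty nx nw H) × Uncertainty nx nw H |
        ¬ Satisfies f Spec (imdpSynthesis f G I solver (List.ofFn p.1)) p.2}
      = ⋃ c, (count ⁻¹' {c}) ×ˢ (closedLoop f (π c) ⁻¹' Spec)ᶜ := by
    ext p
    rw [Set.mem_ofPred_eq, hπ, Set.mem_iUnion]
    constructor
    · intro hp
      exact ⟨count p.1, rfl, hp⟩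
    · rintro ⟨c, rfl, hp⟩
      exact hp
  rw [h]
  exact MeasurableSet.iUnion fun c => (hcount (measurableSet_singleton c)).prod
    (measurable_closedLoop hf (fun t => measurable_refinePolicy hcell hctrl _ t) hSpec).compl

end Synthesis

end P2L

theorem corollary3
    {nx nu nw H : ℕ} (f : Dynamics nx nu nw H) (Spec : Set (Trajectory nx nu H))
    (Pz : Measure (Uncertainty nx nw H)) [IsProbabilityMeasure Pz]
    {Ω : Type*} [MeasurableSpace Ω] (P : Measure Ω) [IsProbabilityMeasure P]
    (N Ni : ℕ) (hNi : Ni ≤ N)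
    (z : Fin N → Ω → Uncertainty nx nw H) (hz : ∀ i, Measurable (z i))
    (hindep : iIndepFun z P) (hlaw : ∀ i, P.map (z i) = Pz)
    (δ : ℝ) (hδ0 : 0 < δ) (hδ1 : δ < 1) :
    -- P2L with the synthesis algorithm based on an IMDP abstraction and lexicographic selection
    ((∀ t, Measurable fun p : (Fin nx → ℝ) × (Fin nu → ℝ) × (Fin nw → ℝ) =>
        f t p.1 p.2.1 p.2.2) →
      MeasurableSet Spec →
      ∀ (S A : Type) [Fintype S] [Fintype A] [Nonempty A] (G : Discretization nx nu S A),
      (∀ s, MeasurableSet (G.cell ⁻¹' {s})) → (∀ a, Measurable (G.ctrl a)) →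
      ∀ (I : IntervalRule) (solver : IMDP S A → AbsPolicy S A),
      (∀ M, IsRobustlyOptimal M G Spec (solver M)) →
      ∀ init : List (Uncertainty nx nw H) → Policy nx nu H,
      MeasurableRule (Satisfies f Spec) (fun _ => lexOrder) init Ni →
      let out : Ω → Policy nx nu H × List (Uncertainty nx nw H) := fun ω =>
        p2lInit (imdpSynthesis f G I solver) (Satisfies f Spec) (fun _ => lexOrder) init Ni
          (List.ofFn fun i => z i ω)
      let good : Set Ω :=
        {ω | Pz.real {ζ | ¬ Satisfies f Spec (out ω).1 ζ} ≤ epsBar (out ω).2.length δ (N - Ni)}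
      MeasurableSet good ∧ 1 - δ ≤ P.real good) ∧
    -- the same for any other synthesis algorithm and quantifier of the degree of dissatisfaction
    (∀ (L init : List (Uncertainty nx nw H) → Policy nx nu H)
      (ord : Policy nx nu H → LinearOrder (Uncertainty nx nw H)),
      (∀ k, MeasurableRule (Satisfies f Spec) ord L k) →
      MeasurableRule (Satisfies f Spec) ord init Ni →
      let out : Ω → Policy nx nu H × List (Uncertainty nx nw H) := fun ω =>
        p2lInit L (Satisfies f Spec) ord init Ni (List.ofFn fun i => z i ω)
      let good : Set Ω :=
        {ω | Pz.real {ζ | ¬ Satisfies f Spec (out ω).1 ζ} ≤ epsBar (out ω).2.length δ (N - Ni)}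
      MeasurableSet good ∧ 1 - δ ≤ P.real good) := by
  refine ⟨?_, ?_⟩
  · intro hf hSpec S A _ _ _ G hcell hctrl I solver _ init hinit
    exact risk_le_epsBar hNi hz hindep hlaw hδ0 hδ1
      (measurableRule_imdpSynthesis hf hSpec hcell hctrl I solver) hinit
  · intro L init ord hL hinit
    exact risk_le_epsBar hNi hz hindep hlaw hδ0 hδ1 hL hinit
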